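/- **Definitions.** Fix an integer $n\ge 1$. A *tableau* is a standard Young tableau of shape $3\times n$: a filling of three rows (numbered $1,2,3$ from bottom to top) of length $n$ by the numbers $1,\dots,3n$, each used once, increasing along the rows from left to right and along the columns from bottom to top. The *Schützenberger involution* rotates a tableau by $180^\circ$ and replaces each entry $i$ by $3n+1-i$. A *PC prograph* of size $n$ is a connected oriented planar graph without directed cycles, drawn in the plane up to deformation, whose vertices are $n$ coproducts (one input, two outputs) and $n$ products (two inputs, one output). Exactly one coproduct has its input unconnected (the input of the prograph), exactly one product has its output unconnected (the output of the prograph), and both of these dangling half-edges lie in the exterior face. A *rooted bipolar-oriented triangulation of the sphere* with $2n$ triangles is a connected planar map on the sphere (multiple edges allowed), up to orientation-preserving homeomorphism, with $2n$ faces, all of degree $3$, together with an orientation of its edges without directed cycles that has exactly one source and exactly one sink (the poles), and a distinguished root edge from the source to the sink. *From tableaux to prographs.* Given a tableau, start with one wire, the input of the prograph, and read $1,2,\dots,3n$ in this order; each number labels the leftmost wire not yet labelled. If the number is in row $1$, its wire becomes the input of a new coproduct, and the left and right outputs of this coproduct take its place among the unlabelled wires. If it is in row $2$, its wire is put aside to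 the left, to become the left input of a later product. If it is in row $3$, its wire becomes the right input of a new product, whose left input is the rightmost wire that was put aside and not yet used, and the output of this product becomes the leftmost unlabelled wire. The one wire left at the end is the output of the prograph. *Graph duality.* Given a PC prograph, embed it on the sphere, connect its output to its input by an edge through the exterior, and take the dual map; each dual edge is directed so that it crosses the corresponding directed edge of the prograph from left to right, and the root edge is the one dual to the added edge. **Theorem.** For every $n\ge 1$: 1. The first construction is a bijection from the $3\times n$ standard Young tableaux onto the PC prographs of size $n$, and graph duality is a bijection from the PC prographs of size $n$ onto the rooted bipolar-oriented triangulations of the sphere with $2n$ triangles. Hence their composition $\Phi$ is an explicit bijection from the $3\times n$ standard Young tableaux onto the rooted bipolar-oriented triangulations of the sphere with $2n$ triangles. 2. $\Phi$ commutes with the Schützenberger involution: if $T'$ is the image of a tableau $T$ under it, then $\Phi(T')$ is obtained from $\Phi(T)$ by rotating the sphere by $180^\circ$ so that the poles are swapped (the root edge being kept) and reversing the direction of every edge. -/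

import Mathlib

namespace PC

open Equiv

/-! ## Three-row rectangular standard Young tableaux -/

/-- A standard Young tableau of shape `3 × n`. Row `0` is the row that contains the smallest
entry (the bottom row in French notation), and entries increase along rows and along columns.
The value `i : Fin (3 * n)` stands for the entry `i + 1 ∈ {1, …, 3n}`. -/
structure Tableau (n : ℕ) where
  entry : Fin 3 × Fin n ≃ Fin (3 * n)
  row_lt : ∀ r : Fin 3, StrictMono fun k : Fin n => entry (r, k)
  col_lt : ∀ k : Fin n, StrictMono fun r : Fin 3 => entry (r, k)

/-- The Schützenberger involution on rectangular tableaux: rotate the tableau by 180 degrees and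
replace every entry `i ∈ {1, …, 3n}` by `3n + 1 - i`. -/
def Tableau.schutzenberger {n : ℕ} (T : Tableau n) : Tableau n where
  entry := ((Fin.revPerm.prodCongr Fin.revPerm).trans T.entry).trans Fin.revPerm
  row_lt := fun r a b h => by
    have := T.row_lt r.rev (Fin.rev_lt_rev.mpr h)
    simpa [Fin.rev_lt_rev] using this
  col_lt := fun k a b h => by
    have := T.col_lt k.rev (Fin.rev_lt_rev.mpr h)
    simpa [Fin.rev_lt_rev] using this

/-! ## Oriented graphs drawn on surfaces -/

/-- Raw data of an oriented graph drawn on an oriented surface, up to homeomorphism.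
`D` is the finite set of half-edges, `σ` sends a half-edge to the next one counterclockwise around
its vertex (so vertices are the cycles of `σ`), `α` exchanges the two halves of every edge (a
fixed point of `α` is a dangling, unconnected half-edge), and `out d` says that the edge containing
`d` is directed away from the vertex of `d`. -/
structure OMap where
  D : Type
  [finite : Finite D]
  [decEq : DecidableEq D]
  σ : Perm D
  α : Perm D
  out : D → Bool

attribute [instance] OMap.finite OMap.decEq

namespace OMap

/-- `α` is an involution, and the two halves of an edge carry opposite directions. -/
def WellFormed (M : OMap) : Prop :=
  (∀ d, M.α (M.α d) = d) ∧ ∀ d, M.α d ≠ d → M.out (M.α d) = !(M.out d)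

def Connected (M : OMap) : Prop :=
  ∀ x y : M.D, Relation.EqvGen (fun a b => b = M.σ a ∨ b = M.α a) x y

/-- The face permutation: walk along the half-edge `d` and then turn to the next edge of the
boundary of the face lying to the left of `d`. Its cycles are the faces. -/
def φ (M : OMap) : Perm M.D := M.σ⁻¹ * M.α

noncomputable def numVertices (M : OMap) : ℕ := Nat.card (Quotient (Perm.SameCycle.setoid M.σ))

noncomputable def numEdges (M : OMap) : ℕ := Nat.card (Quotient (Perm.SameCycle.setoid M.α))

noncomputable def numFaces (M : OMap) : ℕ := Nat.card (Quotient (Perm.SameCycle.setoid M.φ))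

/-- A connected map without dangling half-edges lies on the sphere iff `V - E + F = 2`. -/
def Spherical (M : OMap) : Prop := M.numVertices + M.numFaces = M.numEdges + 2

/-- There is an edge directed from the vertex of `x` to the vertex of `y`. -/
def Arc (M : OMap) (x y : M.D) : Prop :=
  ∃ d, M.out d = true ∧ M.α d ≠ d ∧ M.σ.SameCycle x d ∧ M.σ.SameCycle (M.α d) y

/-- There is no directed cycle. -/
def Acyclic (M : OMap) : Prop := ∀ x, ¬ Relation.TransGen M.Arc x x

/-- The vertex of `d` is a source: all its edges leave it. -/
def IsSource (M : OMap) (d : M.D) : Prop := ∀ e, M.σ.SameCycle d e → M.out e = true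

/-- The vertex of `d` is a sink: all its edges enter it. -/
def IsSink (M : OMap) (d : M.D) : Prop := ∀ e, M.σ.SameCycle d e → M.out e = false

/-- `d` is the input of a coproduct: its vertex has exactly one other pair of half-edges, both
outputs. Drawn with the input at the bottom, `σ d` is the right output and `σ (σ d)` is the left
output. -/
def IsCoproduct (M : OMap) (d : M.D) : Prop :=
  M.σ (M.σ (M.σ d)) = d ∧ M.out d = false ∧ M.out (M.σ d) = true ∧ M.out (M.σ (M.σ d)) = true ∧
    M.σ (M.σ d) ≠ M.σ d

/-- `d` is the output of a product: its vertex has exactly one other pair of half-edges, both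
inputs. Drawn with the output at the top, `σ d` is the left input and `σ (σ d)` is the right
input. -/
def IsProduct (M : OMap) (d : M.D) : Prop :=
  M.σ (M.σ (M.σ d)) = d ∧ M.out d = true ∧ M.out (M.σ d) = false ∧ M.out (M.σ (M.σ d)) = false ∧
    M.σ (M.σ d) ≠ M.σ d

/-- The dual map, for a map without dangling half-edges. Vertices and faces are exchanged; the
half-edge `d` becomes the half, issued from the face to the left of `d`, of the dual edge that
crosses the edge of `d`. Dual edges are directed so that they cross the original directed edges
from left to right. -/
def dual (M : OMap) : OMap where
  D := M.D
  σ := M.φ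
  α := M.α
  out := M.out

/-- Reversing the direction of all edges, without changing the drawing. -/
def reverse (M : OMap) : OMap where
  D := M.D
  σ := M.σ
  α := M.α
  out := fun d => !(M.out d)

end OMap

/-! ## Product-coproduct prographs -/

/-- Raw data of a prograph: an oriented map with a marked half-edge, the global input, and a
marked half-edge, the global output. -/
structure PrographData extends OMap where
  inLeg : D
  outLeg : D

/-- Connect the global output to the global input by an edge through the exterior. -/
def PrographData.close (M : PrographData) : OMap where
  D := M.D
  σ := M.σ
  α := M.α * swap M.inLeg M.outLeg
  out := M.out

/-- PC prographs of size `n`, that is, with `n` products and `n` coproducts: connected oriented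
graphs without directed cycles, all of whose vertices are products or coproducts, with a unique
unconnected input, belonging to a coproduct, and a unique unconnected output, belonging to a
product, drawn in the plane with the unconnected input and output in the exterior (so that
the graph stays planar when they are joined through the exterior). -/
structure PrographData.IsPCPrograph (n : ℕ) (M : PrographData) : Prop where
  wellFormed : M.WellFormed
  operators : ∀ d, ∃ e, M.σ.SameCycle d e ∧ (M.IsCoproduct e ∨ M.IsProduct e)
  inLeg_iff : ∀ d, (M.α d = d ∧ M.out d = false) ↔ d = M.inLeg
  outLeg_iff : ∀ d, (M.α d = d ∧ M.out d = true) ↔ d = M.outLeg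
  inLeg_coproduct : M.IsCoproduct M.inLeg
  outLeg_product : M.IsProduct M.outLeg
  connected : M.Connected
  acyclic : M.Acyclic
  planar : M.close.Spherical
  size : M.numVertices = 2 * n

/-- Isomorphism of prographs: a bijection between the half-edges that respects all the data,
i.e. equality up to a deformation of the plane. -/
def PrographData.Iso (M N : PrographData) : Prop :=
  ∃ f : M.D ≃ N.D, (∀ d, f (M.σ d) = N.σ (f d)) ∧ (∀ d, f (M.α d) = N.α (f d)) ∧
    (∀ d, N.out (f d) = M.out d) ∧ f M.inLeg = N.inLeg ∧ f M.outLeg = N.outLeg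

instance PrographData.isoSetoid : Setoid PrographData where
  r := PrographData.Iso
  iseqv :=
    { refl := fun M => ⟨Equiv.refl _, by simp⟩
      symm := by
        rintro M N ⟨f, h1, h2, h3, h4, h5⟩
        refine ⟨f.symm, fun d => ?_, fun d => ?_, fun d => ?_, ?_, ?_⟩
        · rw [symm_apply_eq, h1, apply_symm_apply]
        · rw [symm_apply_eq, h2, apply_symm_apply]
        · rw [← h3, apply_symm_apply]
        · rw [symm_apply_eq, h4]
        · rw [symm_apply_eq, h5]
      trans := by
        rintro M N K ⟨f, h1, h2, h3, h4, h5⟩ ⟨g, k1, k2, k3, k4, k5⟩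
        exact ⟨f.trans g, by simp [h1, k1], by simp [h2, k2], by simp [h3, k3],
          by simp [h4, k4], by simp [h5, k5]⟩ }

/-- Prographs up to isomorphism. -/
def PrographClass : Type 1 := Quotient PrographData.isoSetoid

/-- The set of PC prographs of size `n`, up to isomorphism. -/
def pcPrographs (n : ℕ) : Set PrographClass := {c | ∃ M, M.IsPCPrograph n ∧ c = Quotient.mk _ M}

/-! ## Rooted bipolar-oriented triangulations of the sphere -/

/-- Raw data of an oriented map with a root half-edge. -/
structure RootedData extends OMap where
  root : D

/-- Rooted bipolar-oriented triangulations of the sphere with `2n` triangles: connected maps on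
the sphere (multiple edges are allowed) all of whose faces have degree three, with an orientation
of the edges without directed cycles that has a unique source and a unique sink (the two poles),
and with a distinguished (root) edge from the source to the sink. -/
structure RootedData.IsBipolarTriangulation (n : ℕ) (M : RootedData) : Prop where
  wellFormed : M.WellFormed
  no_dangling : ∀ d, M.α d ≠ d
  connected : M.Connected
  spherical : M.Spherical
  triangles : ∀ d, M.φ d ≠ d ∧ M.φ (M.φ (M.φ d)) = d
  acyclic : M.Acyclic
  source : ∀ d, M.IsSource d ↔ M.σ.SameCycle M.root d
  sink : ∀ d, M.IsSink d ↔ M.σ.SameCycle (M.α M.root) d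
  size : M.numFaces = 2 * n

/-- Isomorphism of rooted oriented maps: a bijection between the half-edges that respects all the
data, i.e. equality up to a deformation of the sphere. -/
def RootedData.Iso (M N : RootedData) : Prop :=
  ∃ f : M.D ≃ N.D, (∀ d, f (M.σ d) = N.σ (f d)) ∧ (∀ d, f (M.α d) = N.α (f d)) ∧
    (∀ d, N.out (f d) = M.out d) ∧ f M.root = N.root

instance RootedData.isoSetoid : Setoid RootedData where
  r := RootedData.Iso
  iseqv :=
    { refl := fun M => ⟨Equiv.refl _, by simp⟩
      symm := by
        rintro M N ⟨f, h1, h2, h3, h4⟩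
        refine ⟨f.symm, fun d => ?_, fun d => ?_, fun d => ?_, ?_⟩
        · rw [symm_apply_eq, h1, apply_symm_apply]
        · rw [symm_apply_eq, h2, apply_symm_apply]
        · rw [← h3, apply_symm_apply]
        · rw [symm_apply_eq, h4]
      trans := by
        rintro M N K ⟨f, h1, h2, h3, h4⟩ ⟨g, k1, k2, k3, k4⟩
        exact ⟨f.trans g, by simp [h1, k1], by simp [h2, k2], by simp [h3, k3],
          by simp [h4, k4]⟩ }

/-- Rooted oriented maps up to isomorphism. -/
def RootedClass : Type 1 := Quotient RootedData.isoSetoid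

/-- The set of rooted bipolar-oriented triangulations of the sphere with `2n` triangles, up to
isomorphism. -/
def bipolarTriangulations (n : ℕ) : Set RootedClass :=
  {c | ∃ M, M.IsBipolarTriangulation n ∧ c = Quotient.mk _ M}

/-- The 180 degree rotation of the sphere that swaps the poles, together with the reversal of the
direction of all edges. The rotation does not change the cyclic orders around vertices; the root
edge, which joins the poles, is now read from the other end. -/
def RootedData.rotate (M : RootedData) : RootedData where
  toOMap := M.toOMap.reverse
  root := M.α M.root

/-- `RootedData.rotate` on isomorphism classes. -/
def RootedClass.rotate : RootedClass → RootedClass :=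
  Quotient.map RootedData.rotate (by
    rintro M N ⟨f, h1, h2, h3, h4⟩
    refine ⟨f, h1, h2, fun d => ?_, ?_⟩
    · exact congrArg (fun b => !b) (h3 d)
    · exact (h2 _).trans (congrArg N.α h4))

/-! ## Graph duality -/

/-- Graph duality: draw the prograph on the sphere, connect its global output to its global input
through the exterior, and take the dual map. The root edge is the one dual to the new edge. -/
def PrographData.dual (M : PrographData) : RootedData where
  toOMap := M.close.dual
  root := M.outLeg

/-- Graph duality on isomorphism classes. -/
def PrographClass.dual : PrographClass → RootedClass :=
  Quotient.map PrographData.dual (by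
    rintro M N ⟨f, h1, h2, h3, h4, h5⟩
    have hα : ∀ d : M.D, f (M.α (swap M.inLeg M.outLeg d)) =
        N.α (swap N.inLeg N.outLeg (f d)) := fun d => by
      rw [h2, ← h4, ← h5, Function.Injective.swap_apply f.injective]
    have hσ : ∀ d : M.D, f (M.σ⁻¹ d) = N.σ⁻¹ (f d) := fun d => by
      rw [Perm.eq_inv_iff_eq, ← h1]; exact congrArg f (M.σ.apply_symm_apply d)
    exact ⟨f, fun d => (hσ _).trans (congrArg (fun x => N.σ⁻¹ x) (hα d)), hα, h3, h5⟩)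

/-! ## From tableaux to prographs -/

/-- The half-edges of `n` coproducts `Sum.inl k` and `n` products `Sum.inr k`, numbered
counterclockwise around each operator. -/
abbrev Half (n : ℕ) : Type := (Fin n ⊕ Fin n) × Fin 3

section Halves

variable {n : ℕ}

def copIn (k : Fin n) : Half n := (Sum.inl k, 0)

def copRight (k : Fin n) : Half n := (Sum.inl k, 1)

def copLeft (k : Fin n) : Half n := (Sum.inl k, 2)

def prodOut (k : Fin n) : Half n := (Sum.inr k, 0)

def prodLeft (k : Fin n) : Half n := (Sum.inr k, 1)

def prodRight (k : Fin n) : Half n := (Sum.inr k, 2)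

end Halves

/-- State of the assembling of a prograph from bottom to top: the wires that have not been read
yet, from left to right; the wires that wait to become the left input of a product (the rightmost
one first); and the matching of half-edges made so far. A wire is given by the half-edge it comes
from. -/
structure Assembly (n : ℕ) where
  pending : List (Half n)
  waiting : List (Half n)
  glue : Perm (Half n)

/-- Read the next entry of the tableau. It labels the leftmost pending wire.
If it lies in the first row, the wire becomes the input of a new coproduct.
If it lies in the second row, the wire becomes the left input of a product to be determined later.
If it lies in the third row, the wire becomes the right input of a new product, the left input of
which is the closest waiting wire. The index of an operator is the column of the entry read. -/
def Assembly.step {n : ℕ} (T : Tableau n) (s : Assembly n) (i : Fin (3 * n)) : Assembly n :=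
  match T.entry.symm i, s.pending, s.waiting with
  | (0, k), o :: P, W => ⟨copLeft k :: copRight k :: P, W, s.glue * swap o (copIn k)⟩
  | (1, _), o :: P, W => ⟨P, o :: W, s.glue⟩
  | (2, k), o :: P, w :: W =>
      ⟨prodOut k :: P, W, s.glue * swap w (prodLeft k) * swap o (prodRight k)⟩
  | _, _, _ => s

/-- The prograph of a tableau: start with a single wire, the global input (formally the input of
the first coproduct, so that this half-edge stays unconnected), and read the entries of the tableau
in increasing order. -/
def Tableau.prograph {n : ℕ} [NeZero n] (T : Tableau n) : PrographData where
  D := Half n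
  σ := (Equiv.refl _).prodCongr (Equiv.addRight 1)
  α := ((List.finRange (3 * n)).foldl (Assembly.step T) ⟨[copIn 0], [], 1⟩).glue
  out := fun d => match d with
    | (Sum.inl _, s) => s != 0
    | (Sum.inr _, s) => s == 0
  inLeg := copIn 0
  outLeg := prodOut (Fin.rev 0)

/-- The class of the prograph of a tableau. -/
def Tableau.toPrograph {n : ℕ} [NeZero n] (T : Tableau n) : PrographClass :=
  Quotient.mk _ T.prograph

/-- The class of the dual of the prograph of a tableau. -/
def Tableau.toTriangulation {n : ℕ} [NeZero n] (T : Tableau n) : RootedClass :=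
  T.toPrograph.dual

end PC

/-!
A cut through a prograph at the moment when its leftmost unlabelled wire is about to be labelled
consists of that wire, of the stack of the wires put aside to the left, and of the stack of the
wires to the right. An upward sweep by such cuts (a *reading*) labels every wire once, and the
word of the rows of the labels, a ballot word with three letters, is the tableau. Two stacks are
determined by their pushes and pops, so the word determines the prograph, and it is determined by
it since each step of the sweep is forced. The gluing that defines the prograph of a tableau is a
reading whose word is the word of the tableau.

A PC prograph has a reading because it is planar and acyclic. Every face away from the root edge
has edges of both directions on its boundary, hence a lowest and a highest corner; by Euler's
formula there are just enough coproducts and products for these corners to be unique. Then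
consecutive wires of a cut are always separated by a single face, and the sweep never gets stuck.
Conversely, a sweep yields heights and face labels that exclude directed cycles in the map and in
its dual, and a count of the faces that gives planarity.

The closed prograph can be recovered from its dual, faces of degree three becoming operators since
no triangle is a directed cycle. Finally, a rotation by 180 degrees turns a reading into the
reading in the opposite order, with the letters `0` and `2` exchanged: this is the effect of the
Schützenberger involution on words.
-/

namespace PC

open Equiv

/-! ## Cycles of permutations -/

section Perm

variable {D : Type*} {f : Perm D}

theorem sameCycle_self_apply (f : Perm D) (x : D) : f.SameCycle x (f x) :=
  Perm.sameCycle_apply_right.2 (.refl f x)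

theorem card_eq_prime_mul_card_cycles {p : ℕ} (hp : p.Prime) (hf : f ^ p = 1)
    (hfix : ∀ d, f d ≠ d) :
    Nat.card D = p * Nat.card (Quotient (Perm.SameCycle.setoid f)) := by
  rcases isEmpty_or_nonempty D with hD | ⟨⟨d⟩⟩
  · simp
  have hf1 : f ≠ 1 := fun h => hfix d (by simp [h])
  have := Fact.mk hp
  have hcard : Nat.card (Subgroup.zpowers f) = p := by
    rw [Nat.card_zpowers, orderOf_eq_prime hf hf1]
  have := Fact.mk (hcard ▸ hp)
  have hfree (x : D) : MulAction.stabilizer (Subgroup.zpowers f) x = ⊥ :=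
    (Subgroup.eq_bot_or_eq_top_of_prime_card _).resolve_right fun h =>
      hfix x ((Subgroup.eq_top_iff' _).1 h ⟨f, Subgroup.mem_zpowers f⟩)
  have hrel : MulAction.orbitRel (Subgroup.zpowers f) D = Perm.SameCycle.setoid f := by
    ext x y
    rw [MulAction.orbitRel_apply, MulAction.mem_orbit_iff]
    exact Subgroup.exists_zpowers.trans Perm.sameCycle_comm
  rw [Nat.card_congr (MulAction.selfEquivOrbitsQuotientProd hfree), Nat.card_prod, hcard, hrel,
    mul_comm]

theorem eq_or_eq_or_eq_of_sameCycle (h3 : ∀ d, f (f (f d)) = d) {x y : D}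
    (h : f.SameCycle x y) : y = x ∨ y = f x ∨ y = f (f x) := by
  obtain ⟨i, rfl⟩ := h
  have hf : f ^ (3 : ℤ) = 1 := Perm.ext fun d => by simp [zpow_ofNat, pow_succ, h3]
  rw [zpow_eq_zpow_emod i hf]
  have hi0 : 0 ≤ i % 3 := Int.emod_nonneg i three_ne_zero
  have hi3 : i % 3 < 3 := Int.emod_lt_of_pos i three_pos
  interval_cases i % 3 <;> simp [zpow_ofNat, pow_two]

theorem exists_sameCycle_transition [Finite D] (b : D → Bool) {x y : D}
    (h : f.SameCycle x y) (hxy : b x ≠ b y) :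
    ∃ z, f.SameCycle x z ∧ b z = b x ∧ b (f z) ≠ b x := by
  by_contra! hb
  obtain ⟨i, rfl⟩ := h.exists_nat_pow_eq
  refine hxy (Eq.symm ?_)
  clear h hxy
  induction i with
  | zero => rfl
  | succ i ih =>
    rw [pow_succ', Perm.mul_apply]
    exact hb _ ⟨i, by simp⟩ ih

theorem transGen_self_of_forall_sameCycle [Finite D] {r : D → D → Prop} {x : D}
    (h : ∀ y, f.SameCycle x y → r y (f y)) : Relation.TransGen r x x := by
  have reach (i : ℕ) : Relation.TransGen r x ((f ^ (i + 1)) x) := by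
    induction i with
    | zero => exact .single (h x (.refl f x))
    | succ i ih =>
      rw [pow_succ' f (i + 1)]
      exact ih.tail (h _ (Perm.sameCycle_pow_right.2 (.refl f x)))
  simpa [Nat.sub_add_cancel (orderOf_pos f), pow_orderOf_eq_one] using reach (orderOf f - 1)

end Perm

/-! ## Cubic maps -/

namespace OMap

variable {K : OMap} {c c' p p' : K.D}

theorem IsCoproduct.out_self (hc : K.IsCoproduct c) : K.out c = false := hc.2.1

theorem IsCoproduct.out_σ (hc : K.IsCoproduct c) : K.out (K.σ c) = true := hc.2.2.1

theorem IsCoproduct.out_σ_σ (hc : K.IsCoproduct c) : K.out (K.σ (K.σ c)) = true := hc.2.2.2.1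

theorem IsProduct.out_self (hp : K.IsProduct p) : K.out p = true := hp.2.1

theorem IsProduct.out_σ (hp : K.IsProduct p) : K.out (K.σ p) = false := hp.2.2.1

theorem IsProduct.out_σ_σ (hp : K.IsProduct p) : K.out (K.σ (K.σ p)) = false := hp.2.2.2.1

theorem IsCoproduct.ne_σ (hc : K.IsCoproduct c) (hp : K.IsProduct p) : c ≠ K.σ p :=
  ne_of_apply_ne (fun d => K.out (K.σ d)) (by simp [hc.out_σ, hp.out_σ_σ])

theorem IsCoproduct.ne_σ_σ (hc : K.IsCoproduct c) (hp : K.IsProduct p) : c ≠ K.σ (K.σ p) :=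
  ne_of_apply_ne (fun d => K.out (K.σ (K.σ d))) (by simp [hc.out_σ_σ, hp.1, hp.out_σ])

theorem IsCoproduct.σ_ne_σ_σ (hc : K.IsCoproduct c) (hc' : K.IsCoproduct c') :
    K.σ c ≠ K.σ (K.σ c') :=
  K.σ.injective.ne (ne_of_apply_ne K.out (by simp [hc.out_self, hc'.out_σ]))

theorem IsProduct.ne_σ (hp : K.IsProduct p) (hc : K.IsCoproduct c) : p ≠ K.σ c :=
  ne_of_apply_ne (fun d => K.out (K.σ d)) (by simp [hp.out_σ, hc.out_σ_σ])

theorem IsProduct.ne_σ_σ (hp : K.IsProduct p) (hc : K.IsCoproduct c) : p ≠ K.σ (K.σ c) :=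
  ne_of_apply_ne (fun d => K.out (K.σ (K.σ d))) (by simp [hp.out_σ_σ, hc.1, hc.out_σ])

theorem IsProduct.σ_ne_σ_σ (hp : K.IsProduct p) (hp' : K.IsProduct p') :
    K.σ p ≠ K.σ (K.σ p') :=
  K.σ.injective.ne (ne_of_apply_ne K.out (by simp [hp.out_self, hp'.out_σ]))

end OMap

namespace RootedData

/-- A prograph the output of which has been connected to its input. The root is the half-edge at
the output. -/
structure IsCubic (K : RootedData) : Prop where
  α_α : ∀ d, K.α (K.α d) = d
  out_α : ∀ d, K.out (K.α d) = !(K.out d)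
  operators : ∀ d, ∃ e, K.σ.SameCycle d e ∧ (K.IsCoproduct e ∨ K.IsProduct e)
  root_product : K.IsProduct K.root
  root_coproduct : K.IsCoproduct (K.α K.root)

namespace IsCubic

variable {K : RootedData} (hK : K.IsCubic) {d e : K.D}
include hK

theorem α_ne (d : K.D) : K.α d ≠ d :=
  ne_of_apply_ne K.out (by simp [hK.out_α])

theorem α_eq_iff : K.α d = e ↔ d = K.α e :=
  Function.Involutive.eq_iff hK.α_α

theorem out_α_of_out (hd : K.out d = true) : K.out (K.α d) = false := by
  rw [hK.out_α, hd, Bool.not_true]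

theorem out_α_of_in (hd : K.out d = false) : K.out (K.α d) = true := by
  rw [hK.out_α, hd, Bool.not_false]

theorem σ_σ_σ (d : K.D) : K.σ (K.σ (K.σ d)) = d := by
  obtain ⟨e, ⟨z, rfl⟩, he⟩ := hK.operators d
  have h3 : (K.σ ^ 3 * K.σ ^ z) d = (K.σ ^ z) d := he.elim (·.1) (·.1)
  rw [(((Commute.refl K.σ).pow_left 3).zpow_right z).eq] at h3
  exact (K.σ ^ z).injective h3

theorem σ_ne (d : K.D) : K.σ d ≠ d := by
  obtain ⟨e, hde, he⟩ := hK.operators d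
  rw [Ne, hde.apply_eq_self_iff]
  exact fun h => he.elim (·.2.2.2.2 (congrArg K.σ h)) (·.2.2.2.2 (congrArg K.σ h))

theorem φ_apply (d : K.D) : K.φ d = K.σ (K.σ (K.α d)) :=
  Perm.inv_eq_iff_eq.2 (hK.σ_σ_σ _).symm

theorem sameCycle_φ (d : K.D) : K.φ.SameCycle (K.α d) (K.σ (K.σ d)) := by
  simpa only [hK.φ_apply, hK.α_α] using sameCycle_self_apply K.φ (K.α d)

theorem cases (d : K.D) : (∃ c, K.IsCoproduct c ∧ (d = c ∨ d = K.σ c ∨ d = K.σ (K.σ c))) ∨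
    ∃ p, K.IsProduct p ∧ (d = p ∨ d = K.σ p ∨ d = K.σ (K.σ p)) := by
  obtain ⟨e, hde, he | he⟩ := hK.operators d
  · exact .inl ⟨e, he, eq_or_eq_or_eq_of_sameCycle hK.σ_σ_σ hde.symm⟩
  · exact .inr ⟨e, he, eq_or_eq_or_eq_of_sameCycle hK.σ_σ_σ hde.symm⟩

theorem cases_in (hd : K.out d = false) :
    K.IsCoproduct d ∨ ∃ p, K.IsProduct p ∧ (d = K.σ p ∨ d = K.σ (K.σ p)) := by
  rcases hK.cases d with ⟨c, hc, rfl | rfl | rfl⟩ | ⟨p, hp, rfl | h⟩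
  · exact .inl hc
  · simp [hc.out_σ] at hd
  · simp [hc.out_σ_σ] at hd
  · simp [hp.out_self] at hd
  · exact .inr ⟨p, hp, h⟩

theorem cases_out (hd : K.out d = true) :
    K.IsProduct d ∨ ∃ c, K.IsCoproduct c ∧ (d = K.σ c ∨ d = K.σ (K.σ c)) := by
  rcases hK.cases d with ⟨c, hc, rfl | h⟩ | ⟨p, hp, rfl | rfl | rfl⟩
  · simp [hc.out_self] at hd
  · exact .inr ⟨c, hc, h⟩
  · exact .inl hp
  · simp [hp.out_σ] at hd
  · simp [hp.out_σ_σ] at hd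

theorem card_eq_three_mul_numVertices : Nat.card K.D = 3 * K.numVertices :=
  card_eq_prime_mul_card_cycles Nat.prime_three
    (Perm.ext fun d => by simp [pow_succ, hK.σ_σ_σ]) hK.σ_ne

theorem card_eq_two_mul_numEdges : Nat.card K.D = 2 * K.numEdges :=
  card_eq_prime_mul_card_cycles Nat.prime_two
    (Perm.ext fun d => by simp [pow_succ, hK.α_α]) hK.α_ne

end IsCubic

end RootedData

/-! ## Stacks -/

section Stack

variable {A : Type*} {N : ℕ} {l : ℕ → List A} {x : A} {L : List A} {i : ℕ}

/-- Up to the time `N`, the list `l i` evolves by pushing one element, popping one element, or not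
changing. -/
def IsStack (N : ℕ) (l : ℕ → List A) : Prop :=
  ∀ i < N, l (i + 1) = l i ∨ (∃ a, l (i + 1) = a :: l i) ∨ ∃ a, l i = a :: l (i + 1)

theorem IsStack.exists_push (h : IsStack N l) (h0 : l 0 = []) (hi : i ≤ N) (hx : x :: L <:+ l i) :
    ∃ j < i, l j = L ∧ l (j + 1) = x :: L := by
  induction i with
  | zero => simp [h0] at hx
  | succ i ih =>
    have earlier (hx : x :: L <:+ l i) : ∃ j < i + 1, l j = L ∧ l (j + 1) = x :: L := by
      obtain ⟨j, hj, hl⟩ := ih (by omega) hx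
      exact ⟨j, by omega, hl⟩
    rcases h i hi with heq | ⟨a, ha⟩ | ⟨a, ha⟩
    · exact earlier (heq ▸ hx)
    · rw [ha, List.suffix_cons_iff] at hx
      rcases hx with hx | hx
      · obtain ⟨rfl, rfl⟩ := List.cons.inj hx
        exact ⟨i, by omega, rfl, ha⟩
      · exact earlier hx
    · exact earlier (ha ▸ hx.trans (List.suffix_cons _ _))

theorem IsStack.exists_pop (h : IsStack N l) (hN : l N = []) (hi : i ≤ N) (hx : x :: L <:+ l i) :
    ∃ j, i ≤ j ∧ j < N ∧ l j = x :: L ∧ l (j + 1) = L := by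
  induction hi using Nat.decreasingInduction with
  | self => simp [hN] at hx
  | of_succ i hi ih =>
    have later (hx : x :: L <:+ l (i + 1)) :
        ∃ j, i ≤ j ∧ j < N ∧ l j = x :: L ∧ l (j + 1) = L := by
      obtain ⟨j, hj, hl⟩ := ih hx
      exact ⟨j, by omega, hl⟩
    rcases h i hi with heq | ⟨a, ha⟩ | ⟨a, ha⟩
    · exact later (heq ▸ hx)
    · exact later (ha ▸ hx.trans (List.suffix_cons _ _))
    · rw [ha, List.suffix_cons_iff] at hx
      rcases hx with hx | hx
      · obtain ⟨rfl, rfl⟩ := List.cons.inj hx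
        exact ⟨i, le_rfl, hi, ha, rfl⟩
      · exact later hx

end Stack

/-! ## Sweeping a cubic map -/

namespace RootedData

/-- A horizontal cut through a prograph: the wires crossed, each given by its lower half-edge. The
lists to the left and to the right start with the wire next to the current one. -/
structure Scan (K : RootedData) where
  cur : K.D
  left : List K.D
  right : List K.D

/-- The cut moves upwards at the current wire. The letter `r` tells what the upper end of this wire
is: the input of a coproduct (`0`), the left input of a product (`1`), in which case the wire only
leaves the cut once the right input is reached, or the right input of a product (`2`). -/
inductive Step (K : RootedData) (r : Fin 3) (s t : Scan K) : Prop
  | coproduct (hr : r = 0) (hα : K.IsCoproduct (K.α s.cur)) (cur : t.cur = K.σ (K.σ (K.α s.cur)))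
      (left : t.left = s.left) (right : t.right = K.σ (K.α s.cur) :: s.right)
  | leftInput (p : K.D) (hr : r = 1) (hp : K.IsProduct p) (hα : K.α s.cur = K.σ p)
      (left : t.left = s.cur :: s.left) (right : s.right = t.cur :: t.right)
  | product (hr : r = 2) (hp : K.IsProduct t.cur) (hα : K.α s.cur = K.σ (K.σ t.cur))
      (left : s.left = K.α (K.σ t.cur) :: t.left) (right : t.right = s.right)

/-- The cuts `s 0, …, s N` sweep the map from the input to the output. -/
structure IsSweep (K : RootedData) (N : ℕ) (w : ℕ → Fin 3) (s : ℕ → Scan K) : Prop where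
  start : s 0 = ⟨K.root, [], []⟩
  finish : s N = ⟨K.root, [], []⟩
  step : ∀ i < N, K.Step (w i) (s i) (s (i + 1))

/-- A sweep in which every wire is current exactly once. It reads the word `w` off the map. -/
structure IsReading (K : RootedData) (N : ℕ) (w : ℕ → Fin 3) (s : ℕ → Scan K) : Prop
    extends IsSweep K N w s where
  surj : ∀ d, K.out d = true → ∃ i < N, (s i).cur = d
  inj : ∀ i < N, ∀ j < N, (s i).cur = (s j).cur → i = j

variable {K : RootedData} {N : ℕ} {w : ℕ → Fin 3} {s : ℕ → Scan K}

namespace IsSweep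

variable (h : K.IsSweep N w s) {i : ℕ} {x : K.D} {L : List K.D}
include h

theorem cur_zero : (s 0).cur = K.root := by rw [h.start]
theorem left_zero : (s 0).left = [] := by rw [h.start]
theorem right_zero : (s 0).right = [] := by rw [h.start]
theorem cur_last : (s N).cur = K.root := by rw [h.finish]
theorem left_last : (s N).left = [] := by rw [h.finish]
theorem right_last : (s N).right = [] := by rw [h.finish]

theorem isStack_left : IsStack N fun i => (s i).left := fun i hi =>
  match h.step i hi with
  | .coproduct _ _ _ left _ => .inl left
  | .leftInput _ _ _ _ left _ => .inr (.inl ⟨_, left⟩)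
  | .product _ _ _ left _ => .inr (.inr ⟨_, left⟩)

theorem isStack_right : IsStack N fun i => (s i).right := fun i hi =>
  match h.step i hi with
  | .coproduct _ _ _ _ right => .inr (.inl ⟨_, right⟩)
  | .leftInput _ _ _ _ _ right => .inr (.inr ⟨_, right⟩)
  | .product _ _ _ _ right => .inl right

theorem exists_push_left (hi : i ≤ N) (hx : x :: L <:+ (s i).left) :
    ∃ j < i, (s j).cur = x ∧ (s j).left = L ∧ (s j).right = (s (j + 1)).cur :: (s (j + 1)).right ∧
      ∃ p, K.IsProduct p ∧ K.α x = K.σ p := by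
  obtain ⟨j, hj, hL, hxL⟩ := h.isStack_left.exists_push h.left_zero hi hx
  refine ⟨j, hj, ?_⟩
  cases h.step j (by omega) with
  | coproduct hr hα cur left right => simp [hxL, hL] at left
  | leftInput p hr hp hα left right =>
    obtain ⟨rfl, -⟩ := List.cons.inj (hxL.symm.trans left)
    exact ⟨rfl, hL, right, p, hp, hα⟩
  | product hr hp hα left right =>
    exact absurd (congrArg List.length left) (by simp [hxL, hL]; omega)

theorem exists_pop_left (hi : i ≤ N) (hx : x :: L <:+ (s i).left) :
    ∃ j, i ≤ j ∧ j < N ∧ K.IsProduct (s (j + 1)).cur ∧ x = K.α (K.σ (s (j + 1)).cur) ∧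
      K.α (s j).cur = K.σ (K.σ (s (j + 1)).cur) := by
  obtain ⟨j, hij, hj, hxL, hL⟩ := h.isStack_left.exists_pop h.left_last hi hx
  refine ⟨j, hij, hj, ?_⟩
  cases h.step j hj with
  | coproduct hr hα cur left right => simp [hxL, hL] at left
  | leftInput p hr hp hα left right =>
    exact absurd (congrArg List.length left) (by simp [hxL, hL]; omega)
  | product hr hp hα left right => exact ⟨hp, (List.cons.inj (hxL.symm.trans left)).1, hα⟩

theorem exists_push_right (hi : i ≤ N) (hx : x :: L <:+ (s i).right) :
    ∃ j < i, K.IsCoproduct (K.α (s j).cur) ∧ x = K.σ (K.α (s j).cur) ∧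
      (s (j + 1)).cur = K.σ x := by
  obtain ⟨j, hj, hL, hxL⟩ := h.isStack_right.exists_push h.right_zero hi hx
  refine ⟨j, hj, ?_⟩
  cases h.step j (by omega) with
  | coproduct hr hα cur left right =>
    obtain ⟨rfl, -⟩ := List.cons.inj (hxL.symm.trans right)
    exact ⟨hα, rfl, cur⟩
  | leftInput p hr hp hα left right =>
    exact absurd (congrArg List.length right) (by simp [hxL, hL]; omega)
  | product hr hp hα left right => simp [hxL, hL] at right

theorem exists_pop_right (hi : i ≤ N) (hx : x :: L <:+ (s i).right) :
    ∃ j, i ≤ j ∧ j < N ∧ (s (j + 1)).cur = x ∧ (s (j + 1)).right = L ∧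
      (s (j + 1)).left = (s j).cur :: (s j).left := by
  obtain ⟨j, hij, hj, hxL, hL⟩ := h.isStack_right.exists_pop h.right_last hi hx
  refine ⟨j, hij, hj, ?_⟩
  cases h.step j hj with
  | coproduct hr hα cur left right =>
    exact absurd (congrArg List.length right) (by simp [hxL, hL]; omega)
  | leftInput p hr hp hα left right =>
    exact ⟨(List.cons.inj (hxL.symm.trans right)).1.symm, hL, left⟩
  | product hr hp hα left right => simp [hxL, hL] at right

theorem out_cur (hK : K.IsCubic) (hi : i ≤ N) : K.out (s i).cur = true := by
  rcases i with _ | i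
  · exact h.cur_zero ▸ hK.root_product.out_self
  cases h.step i hi with
  | coproduct hr hα cur left right => exact cur ▸ hα.out_σ_σ
  | leftInput p hr hp hα left right =>
    obtain ⟨j, -, hc, hx, -⟩ := h.exists_push_right (Nat.le_of_succ_le hi) (by rw [right])
    exact hx ▸ hc.out_σ
  | product hr hp hα left right => exact hp.out_self

theorem out_α_cur (hK : K.IsCubic) (hi : i ≤ N) : K.out (K.α (s i).cur) = false :=
  hK.out_α_of_out (h.out_cur hK hi)

end IsSweep

namespace IsReading

variable (h : K.IsReading N w s)
include h

theorem pos (hK : K.IsCubic) : 0 < N := by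
  obtain ⟨i, hi, -⟩ := h.surj K.root hK.root_product.out_self
  omega

theorem exists_α_cur (hK : K.IsCubic) {d : K.D} (hd : K.out d = false) :
    ∃ i < N, K.α (s i).cur = d := by
  obtain ⟨i, hi, hc⟩ := h.surj (K.α d) (hK.out_α_of_in hd)
  exact ⟨i, hi, hK.α_eq_iff.2 hc⟩

theorem exists_cur (hK : K.IsCubic) (d : K.D) : ∃ i < N, (s i).cur = d ∨ K.α (s i).cur = d := by
  cases hd : K.out d
  · obtain ⟨i, hi, hc⟩ := h.exists_α_cur hK hd
    exact ⟨i, hi, .inr hc⟩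
  · obtain ⟨i, hi, hc⟩ := h.surj d hd
    exact ⟨i, hi, .inl hc⟩

theorem exists_step_coproduct (hK : K.IsCubic) {c : K.D} (hc : K.IsCoproduct c) :
    ∃ i < N, K.α (s i).cur = c ∧ w i = 0 ∧ (s (i + 1)).cur = K.σ (K.σ c) ∧
      (s (i + 1)).left = (s i).left ∧ (s (i + 1)).right = K.σ c :: (s i).right := by
  obtain ⟨i, hi, rfl⟩ := h.exists_α_cur hK hc.out_self
  refine ⟨i, hi, rfl, ?_⟩
  cases h.step i hi with
  | coproduct hr hα cur left right => exact ⟨hr, cur, left, right⟩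
  | leftInput p hr hp hα left right => exact absurd hα (hc.ne_σ hp)
  | product hr hp hα left right => exact absurd hα (hc.ne_σ_σ hp)

theorem exists_step_product (hK : K.IsCubic) {p : K.D} (hp : K.IsProduct p) :
    ∃ i < N, K.α (s i).cur = K.σ (K.σ p) ∧ w i = 2 ∧ (s (i + 1)).cur = p ∧
      (s (i + 1)).right = (s i).right ∧ (s i).left = K.α (K.σ p) :: (s (i + 1)).left := by
  obtain ⟨i, hi, hp2⟩ := h.exists_α_cur hK hp.out_σ_σ
  refine ⟨i, hi, hp2, ?_⟩
  cases h.step i hi with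
  | coproduct hr hα cur left right => exact absurd hp2 (hα.ne_σ_σ hp)
  | leftInput q hr hq hα left right => exact absurd (hα.symm.trans hp2) (hq.σ_ne_σ_σ hp)
  | product hr hq hα left right =>
    obtain rfl : (s (i + 1)).cur = p := K.σ.injective (K.σ.injective (hα.symm.trans hp2))
    exact ⟨hr, rfl, right, left⟩

end IsReading

end RootedData

/-! ## Corners of faces -/

section Pair

variable {A B : Type*} {f : A → B} {x y : B}

theorem surjective_sumElim_pair (h : ∀ b, b ≠ x → b ≠ y → ∃ a, f a = b) :
    (Sum.elim f ![x, y]).Surjective := fun b => by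
  by_cases hx : b = x
  · exact ⟨.inr 0, by simp [hx]⟩
  by_cases hy : b = y
  · exact ⟨.inr 1, by simp [hy]⟩
  obtain ⟨a, ha⟩ := h b hx hy
  exact ⟨.inl a, ha⟩

variable [Finite A]

theorem card_le_card_add_two (h : ∀ b, b ≠ x → b ≠ y → ∃ a, f a = b) :
    Nat.card B ≤ Nat.card A + 2 := by
  simpa [Nat.card_sum] using Nat.card_le_card_of_surjective _ (surjective_sumElim_pair h)

theorem injective_and_avoids_pair (h : ∀ b, b ≠ x → b ≠ y → ∃ a, f a = b)
    (hcard : Nat.card A + 2 ≤ Nat.card B) : f.Injective ∧ ∀ a, f a ≠ x ∧ f a ≠ y := by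
  have hinj : (Sum.elim f ![x, y]).Injective :=
    ((surjective_sumElim_pair h).bijective_of_nat_card_le (by simpa [Nat.card_sum])).1
  exact ⟨fun a b hab => Sum.inl_injective (@hinj (.inl a) (.inl b) hab),
    fun a => ⟨fun ha => Sum.inl_ne_inr (@hinj (.inl a) (.inr 0) ha),
      fun ha => Sum.inl_ne_inr (@hinj (.inl a) (.inr 1) ha)⟩⟩

end Pair

namespace OMap

variable {K : OMap} {d e : K.D}

/-- The face to the left of the half-edge `d`. -/
def face (K : OMap) (d : K.D) : Quotient (Perm.SameCycle.setoid K.φ) := Quotient.mk _ d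

theorem face_eq_iff : K.face d = K.face e ↔ K.φ.SameCycle d e := Quotient.eq

theorem out_σ_eq_of_operator (hd : K.IsCoproduct d ∨ K.IsProduct d) :
    K.σ (K.σ (K.σ d)) = d ∧ K.out (K.σ d) = !K.out d ∧ K.out (K.σ (K.σ d)) = !K.out d := by
  rcases hd with hd | hd
  · simp [hd.1, hd.out_self, hd.out_σ, hd.out_σ_σ]
  · simp [hd.1, hd.out_self, hd.out_σ, hd.out_σ_σ]

end OMap

namespace RootedData

/-- Every face away from the root edge has edges of both directions on its boundary. This is the
dual form of the absence of further sources and sinks. -/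
def BothDirections (K : RootedData) : Prop :=
  ∀ d, ¬ K.φ.SameCycle d K.root → ¬ K.φ.SameCycle d (K.α K.root) →
    (∃ e, K.φ.SameCycle d e ∧ K.out e = true) ∧ ∃ e, K.φ.SameCycle d e ∧ K.out e = false

/-- The distribution of the lowest corners (between the outputs of a coproduct) and of the highest
corners (between the inputs of a product) over the faces: no face has two highest corners, the two
faces at the root edge have none, and the face to the right of it has no lowest corner. -/
structure FaceCorners (K : RootedData) : Prop where
  top_unique : ∀ p p', K.IsProduct p → K.IsProduct p' →
    K.φ.SameCycle (K.σ p) (K.σ p') → p = p'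
  bottom_right : ∀ c, K.IsCoproduct c → ¬ K.φ.SameCycle (K.α K.root) (K.σ c)
  top_left : ∀ p, K.IsProduct p → ¬ K.φ.SameCycle K.root (K.σ p)
  top_right : ∀ p, K.IsProduct p → ¬ K.φ.SameCycle (K.α K.root) (K.σ p)

namespace IsCubic

variable {K : RootedData} (hK : K.IsCubic) {d : K.D}
include hK

theorem exists_bottom_corner {e : K.D} (hde : K.φ.SameCycle d e) (hd : K.out d = false)
    (he : K.out e = true) : ∃ c, K.IsCoproduct c ∧ K.φ.SameCycle d (K.σ c) := by
  obtain ⟨z, hz, hz1, hz2⟩ := exists_sameCycle_transition K.out hde (by simp [hd, he])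
  rw [hd, hK.φ_apply] at *
  rcases hK.cases_out (hK.out_α_of_in hz1) with hp | ⟨c, hc, h | h⟩
  · exact absurd hp.out_σ_σ hz2
  · exact absurd hc.out_self (by rwa [h, hc.1] at hz2)
  · refine ⟨c, hc, hz.trans ?_⟩
    simpa [hK.φ_apply, h, hc.1] using sameCycle_self_apply K.φ z

theorem exists_top_corner {e : K.D} (hde : K.φ.SameCycle d e) (hd : K.out d = true)
    (he : K.out e = false) : ∃ p, K.IsProduct p ∧ K.φ.SameCycle d (K.σ p) := by
  obtain ⟨z, hz, hz1, hz2⟩ := exists_sameCycle_transition K.out hde (by simp [hd, he])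
  rw [hd, hK.φ_apply] at *
  rcases hK.cases_in (hK.out_α_of_out hz1) with hc | ⟨p, hp, h | h⟩
  · exact absurd hc.out_σ_σ hz2
  · exact absurd hp.out_self (by rwa [h, hp.1] at hz2)
  · refine ⟨p, hp, hz.trans ?_⟩
    simpa [hK.φ_apply, h, hp.1] using sameCycle_self_apply K.φ z

theorem exists_corners (hb : K.BothDirections) (h1 : ¬ K.φ.SameCycle d K.root)
    (h2 : ¬ K.φ.SameCycle d (K.α K.root)) :
    (∃ c, K.IsCoproduct c ∧ K.φ.SameCycle d (K.σ c)) ∧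
      ∃ p, K.IsProduct p ∧ K.φ.SameCycle d (K.σ p) := by
  obtain ⟨⟨e, he, heo⟩, ⟨f, hf, hfo⟩⟩ := hb d h1 h2
  obtain ⟨c, hc, hfc⟩ := hK.exists_bottom_corner (hf.symm.trans he) hfo heo
  obtain ⟨p, hp, hep⟩ := hK.exists_top_corner (he.symm.trans hf) heo hfo
  exact ⟨⟨c, hc, hf.trans hfc⟩, ⟨p, hp, he.trans hep⟩⟩

theorem operator_unique {e : K.D} (hd : K.IsCoproduct d ∨ K.IsProduct d)
    (he : K.IsCoproduct e ∨ K.IsProduct e) (h : K.σ.SameCycle d e) : d = e := by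
  obtain ⟨h3, hd1, hd2⟩ := OMap.out_σ_eq_of_operator hd
  obtain ⟨-, he1, he2⟩ := OMap.out_σ_eq_of_operator he
  rcases eq_or_eq_or_eq_of_sameCycle hK.σ_σ_σ h with rfl | rfl | rfl
  · rfl
  · simp [hd1, hd2] at he1
  · simp [h3, hd1, hd2] at he2

theorem card_operators :
    Nat.card {c // K.IsCoproduct c} + Nat.card {p // K.IsProduct p} = K.numVertices := by
  have hdisj : Disjoint K.IsCoproduct K.IsProduct := by
    rw [Pi.disjoint_iff]
    exact fun d => Prop.disjoint_iff.2 fun h => by simpa [h.1.out_self] using h.2.out_self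
  classical
  rw [← Nat.card_sum, ← Nat.card_congr (subtypeOrEquiv _ _ hdisj)]
  refine Nat.card_eq_of_bijective (fun d => Quotient.mk (Perm.SameCycle.setoid K.σ) d.1)
    ⟨fun d e h => Subtype.ext (hK.operator_unique d.2 e.2 (Quotient.exact h)), fun v => ?_⟩
  induction v using Quotient.inductionOn with | _ d
  obtain ⟨e, hde, he⟩ := hK.operators d
  exact ⟨⟨e, he⟩, Quotient.sound hde.symm⟩

theorem exists_bottom_face_eq (hb : K.BothDirections) (F : Quotient (Perm.SameCycle.setoid K.φ))
    (h1 : F ≠ K.face K.root) (h2 : F ≠ K.face (K.α K.root)) :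
    ∃ c : {c // K.IsCoproduct c}, K.face (K.σ c) = F := by
  induction F using Quotient.inductionOn with | _ d
  obtain ⟨⟨c, hc, h⟩, -⟩ :=
    hK.exists_corners hb (mt OMap.face_eq_iff.2 h1) (mt OMap.face_eq_iff.2 h2)
  exact ⟨⟨c, hc⟩, OMap.face_eq_iff.2 h.symm⟩

theorem exists_top_face_eq (hb : K.BothDirections) (F : Quotient (Perm.SameCycle.setoid K.φ))
    (h1 : F ≠ K.face K.root) (h2 : F ≠ K.face (K.α K.root)) :
    ∃ p : {p // K.IsProduct p}, K.face (K.σ p) = F := by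
  induction F using Quotient.inductionOn with | _ d
  obtain ⟨-, p, hp, h⟩ :=
    hK.exists_corners hb (mt OMap.face_eq_iff.2 h1) (mt OMap.face_eq_iff.2 h2)
  exact ⟨⟨p, hp⟩, OMap.face_eq_iff.2 h.symm⟩

theorem numFaces_le_coproducts (hb : K.BothDirections) :
    K.numFaces ≤ Nat.card {c // K.IsCoproduct c} + 2 :=
  card_le_card_add_two (hK.exists_bottom_face_eq hb)

theorem numFaces_le_products (hb : K.BothDirections) :
    K.numFaces ≤ Nat.card {p // K.IsProduct p} + 2 :=
  card_le_card_add_two (hK.exists_top_face_eq hb)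

-- There are `n` faces away from the root edge and `2 * n` operators, while each of these faces
-- contains at least one lowest and one highest corner: there is no room for any other corner.
theorem faceCorners (hb : K.BothDirections) {n : ℕ} (hV : K.numVertices = 2 * n)
    (hF : K.numFaces = n + 2) : K.FaceCorners := by
  have hcard := hK.card_operators
  have hcop := hK.numFaces_le_coproducts hb
  have hprod := hK.numFaces_le_products hb
  obtain ⟨-, hbottom⟩ :=
    injective_and_avoids_pair (hK.exists_bottom_face_eq hb) (show _ ≤ K.numFaces by omega)
  obtain ⟨hinj, htop⟩ :=
    injective_and_avoids_pair (hK.exists_top_face_eq hb) (show _ ≤ K.numFaces by omega)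
  exact {
    top_unique p p' hp hp' h :=
      congrArg Subtype.val (@hinj ⟨p, hp⟩ ⟨p', hp'⟩ (OMap.face_eq_iff.2 h))
    bottom_right c hc h := (hbottom ⟨c, hc⟩).2 (OMap.face_eq_iff.2 h.symm)
    top_left p hp h := (htop ⟨p, hp⟩).1 (OMap.face_eq_iff.2 h.symm)
    top_right p hp h := (htop ⟨p, hp⟩).2 (OMap.face_eq_iff.2 h.symm) }

end IsCubic

end RootedData

/-! ## Existence of a reading -/

theorem OMap.Connected.forall_of_closed {K : OMap} (hconn : K.Connected) {P : K.D → Prop}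
    (hσ : ∀ d, P d → P (K.σ d)) (hα : ∀ d, P d → P (K.α d)) {d : K.D} (hd : P d) (e : K.D) :
    P e := by
  have hσ_iff (d) : P (K.σ d) ↔ P d :=
    ⟨fun h => by simpa using Perm.perm_symm_on_of_perm_on_finite hσ h, hσ d⟩
  have hα_iff (d) : P (K.α d) ↔ P d :=
    ⟨fun h => by simpa using Perm.perm_symm_on_of_perm_on_finite hα h, hα d⟩
  suffices ∀ d e, Relation.EqvGen (fun a b => b = K.σ a ∨ b = K.α a) d e → (P d ↔ P e) from
    (this d e (hconn d e)).1 hd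
  intro d e h
  induction h with
  | rel d e h =>
    rcases h with rfl | rfl
    · exact (hσ_iff d).symm
    · exact (hα_iff d).symm
  | refl d => rfl
  | symm d e _ ih => exact ih.symm
  | trans d e f _ _ ih1 ih2 => exact ih1.trans ih2

theorem exists_injOn_period {A : Type*} [Finite A] (u : ℕ → A)
    (h : ∀ i j, u (i + 1) = u (j + 1) → u i = u j) :
    ∃ N, 0 < N ∧ u N = u 0 ∧ ∀ i < N, ∀ j < N, u i = u j → i = j := by
  have hback (i k) (hi : u i = u (i + k)) : u k = u 0 := by
    induction i with
    | zero => simpa using hi.symm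
    | succ i ih => exact ih (h _ _ (hi.trans (congrArg u (by omega))))
  have hback' {i j} (hij : i < j) (hu : u i = u j) : 0 < j - i ∧ u (j - i) = u 0 :=
    ⟨by omega, hback i _ (hu.trans (congrArg u (by omega)))⟩
  have hex : ∃ N, 0 < N ∧ u N = u 0 := by
    obtain ⟨i, j, hij, hu⟩ := Finite.exists_ne_map_eq_of_infinite u
    rcases hij.lt_or_gt with hij | hij
    · exact ⟨j - i, hback' hij hu⟩
    · exact ⟨i - j, hback' hij hu.symm⟩
  classical
  refine ⟨Nat.find hex, (Nat.find_spec hex).1, (Nat.find_spec hex).2, fun i hi j hj hu => ?_⟩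
  rcases lt_trichotomy i j with hij | hij | hij
  · exact absurd (hback' hij hu) (Nat.find_min hex (by omega))
  · exact hij
  · exact absurd (hback' hij hu.symm) (Nat.find_min hex (by omega))

namespace RootedData

variable {K : RootedData}

namespace IsSweep

variable {N : ℕ} {w : ℕ → Fin 3} {s : ℕ → Scan K} (h : K.IsSweep N w s) {i : ℕ}

/-- The wire of the half-edge `d` is current at some time: the half-edges of this kind turn out to
be closed under `σ` and `α`. -/
def Visited (K : RootedData) (N : ℕ) (s : ℕ → Scan K) (d : K.D) : Prop :=
  ∃ i ≤ N, (s i).cur = d ∨ K.α (s i).cur = d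

theorem visited_cur (hi : i ≤ N) : Visited K N s (s i).cur := ⟨i, hi, .inl rfl⟩

theorem visited_α_cur (hi : i ≤ N) : Visited K N s (K.α (s i).cur) := ⟨i, hi, .inr rfl⟩

theorem visited_α (hK : K.IsCubic) {d : K.D} (hd : Visited K N s d) : Visited K N s (K.α d) := by
  obtain ⟨i, hi, rfl | rfl⟩ := hd
  · exact visited_α_cur hi
  · rw [hK.α_α]
    exact visited_cur hi

include h

theorem visited_σ_cur (hK : K.IsCubic) (hi : i < N) : Visited K N s (K.σ (s (i + 1)).cur) := by
  cases h.step i hi with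
  | coproduct hr hα cur left right =>
    rw [cur, hα.1]
    exact visited_α_cur hi.le
  | leftInput p hr hp hα left right =>
    obtain ⟨j, hj, -, -, hcur⟩ := h.exists_push_right hi.le (by rw [right])
    exact ⟨j + 1, by omega, .inl hcur⟩
  | product hr hp hα left right =>
    obtain ⟨j, hj, hcur, -⟩ := h.exists_push_left hi.le (by rw [left])
    exact ⟨j, by omega, .inr (by rw [hcur, hK.α_α])⟩

theorem visited_σ_α_cur (hK : K.IsCubic) (hi : i < N) :
    Visited K N s (K.σ (K.α (s i).cur)) := by
  cases h.step i hi with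
  | coproduct hr hα cur left right =>
    obtain ⟨j, -, hj, hcur, -⟩ := h.exists_pop_right hi (by rw [right])
    exact hcur ▸ visited_cur hj
  | leftInput p hr hp hα left right =>
    obtain ⟨j, -, hj, -, hleft, hright⟩ := h.exists_pop_left hi (by rw [left])
    rw [hleft, hK.α_α, ← hright]
    exact visited_α_cur hj.le
  | product hr hp hα left right =>
    rw [hα, hp.1]
    exact visited_cur hi

theorem visited_σ (hK : K.IsCubic) (hN : 0 < N) {d : K.D} (hd : Visited K N s d) :
    Visited K N s (K.σ d) := by
  obtain ⟨i, hi, rfl | rfl⟩ := hd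
  · rcases i with _ | i
    · have := h.visited_σ_cur hK (Nat.sub_one_lt hN.ne')
      rwa [Nat.sub_add_cancel hN, h.cur_last, ← h.cur_zero] at this
    · exact h.visited_σ_cur hK hi
  · rcases hi.lt_or_eq with hi | rfl
    · exact h.visited_σ_α_cur hK hi
    · rw [h.cur_last, ← h.cur_zero]
      exact h.visited_σ_α_cur hK hN

theorem exists_cur_eq (hK : K.IsCubic) (hconn : K.Connected) (hN : 0 < N) {d : K.D}
    (hd : K.out d = true) : ∃ i < N, (s i).cur = d := by
  obtain ⟨i, hi, rfl | rfl⟩ := hconn.forall_of_closed (P := Visited K N s)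
    (fun _ => h.visited_σ hK hN) (fun _ => visited_α hK) (visited_cur N.zero_le) d
  · rcases hi.lt_or_eq with hi | rfl
    · exact ⟨i, hi, rfl⟩
    · exact ⟨0, hN, h.cur_zero.trans h.cur_last.symm⟩
  · simp [h.out_α_cur hK hi] at hd

end IsSweep

/-- Starting with the face of `x`, consecutive wires of the list, from left to right, are separated
by a single face, and the last face is the one to the right of the root edge. -/
def RightChain (K : RootedData) : K.D → List K.D → Prop
  | x, [] => K.φ.SameCycle x (K.α K.root)
  | x, r :: Q => K.φ.SameCycle x r ∧ (∃ c, K.IsCoproduct c ∧ r = K.σ c) ∧ RightChain K (K.α r) Q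

/-- Starting with the face of `x`, consecutive wires of the list, from right to left, are separated
by a single face, and the last face is the one to the left of the root edge. -/
def LeftChain (K : RootedData) : K.D → List K.D → Prop
  | x, [] => K.φ.SameCycle x K.root
  | x, y :: Q => K.φ.SameCycle x (K.α y) ∧ (∃ p, K.IsProduct p ∧ K.α y = K.σ p) ∧ LeftChain K y Q

theorem RightChain.congr {x y : K.D} (h : K.φ.SameCycle x y) {Q : List K.D}
    (hx : K.RightChain x Q) : K.RightChain y Q := by
  cases Q with
  | nil => exact h.symm.trans hx
  | cons r Q => exact ⟨h.symm.trans hx.1, hx.2⟩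

theorem LeftChain.congr {x y : K.D} (h : K.φ.SameCycle x y) {Q : List K.D}
    (hx : K.LeftChain x Q) : K.LeftChain y Q := by
  cases Q with
  | nil => exact h.symm.trans hx
  | cons r Q => exact ⟨h.symm.trans hx.1, hx.2⟩

/-- A cut whose consecutive wires are separated by a single face. -/
structure IsCut (K : RootedData) (s : Scan K) : Prop where
  out_cur : K.out s.cur = true
  right : K.RightChain (K.α s.cur) s.right
  left : K.LeftChain s.cur s.left

namespace IsCut

theorem start (hK : K.IsCubic) : K.IsCut ⟨K.root, [], []⟩ :=
  ⟨hK.root_product.out_self, .refl _ _, .refl _ _⟩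

variable {s t s' t' : Scan K} {r r' : Fin 3}

theorem exists_step_of_coproduct (hK : K.IsCubic) (hs : K.IsCut s)
    (hc : K.IsCoproduct (K.α s.cur)) : ∃ t, K.Step 0 s t ∧ K.IsCut t := by
  refine ⟨⟨K.σ (K.σ (K.α s.cur)), s.left, K.σ (K.α s.cur) :: s.right⟩,
    .coproduct rfl hc rfl rfl rfl, hc.out_σ_σ, ⟨?_, ⟨_, hc, rfl⟩, hs.right.congr ?_⟩,
    hs.left.congr ?_⟩
  · simpa only [hc.1] using hK.sameCycle_φ (K.σ (K.σ (K.α s.cur)))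
  · simpa only [hc.1] using (hK.sameCycle_φ (K.σ (K.α s.cur))).symm
  · simpa only [hK.α_α] using hK.sameCycle_φ (K.α s.cur)

theorem exists_step_of_leftInput (hF : K.FaceCorners) (hs : K.IsCut s) {p : K.D}
    (hp : K.IsProduct p) (hα : K.α s.cur = K.σ p) : ∃ t, K.Step 1 s t ∧ K.IsCut t := by
  obtain ⟨o, L, _ | ⟨r, R⟩⟩ := s
  · exact absurd (hα ▸ hs.right).symm (hF.top_right p hp)
  · obtain ⟨hr, ⟨c, hc, rfl⟩, hR⟩ := hs.right
    exact ⟨⟨K.σ c, o :: L, R⟩, .leftInput p rfl hp hα rfl rfl, hc.out_σ, hR,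
      hr.symm, ⟨p, hp, hα⟩, hs.left⟩

theorem exists_step_of_product (hK : K.IsCubic) (hF : K.FaceCorners) (hs : K.IsCut s) {p : K.D}
    (hp : K.IsProduct p) (hα : K.α s.cur = K.σ (K.σ p)) : ∃ t, K.Step 2 s t ∧ K.IsCut t := by
  have hface : K.φ.SameCycle s.cur (K.σ p) := by
    have := hK.sameCycle_φ (K.σ (K.σ p))
    rwa [hp.1, ← hα, hK.α_α] at this
  obtain ⟨o, _ | ⟨x, L⟩, R⟩ := s
  · exact absurd (hs.left.congr hface).symm (hF.top_left p hp)
  · obtain ⟨hx, ⟨q, hq, hxq⟩, hL⟩ := hs.left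
    obtain rfl := hF.top_unique p q hp hq (hface.symm.trans (hxq ▸ hx))
    refine ⟨⟨p, L, R⟩, .product rfl hp hα (by rw [← hxq, hK.α_α]) rfl, hp.out_self,
      hs.right.congr ?_, hL.congr ?_⟩
    · exact hα ▸ (hK.sameCycle_φ p).symm
    · have := hK.sameCycle_φ (K.σ p)
      rwa [hp.1, ← hxq, hK.α_α] at this

theorem exists_step (hK : K.IsCubic) (hF : K.FaceCorners) (hs : K.IsCut s) :
    ∃ r t, K.Step r s t ∧ K.IsCut t := by
  rcases hK.cases_in (hK.out_α_of_out hs.out_cur) with hc | ⟨p, hp, h | h⟩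
  · exact ⟨0, hs.exists_step_of_coproduct hK hc⟩
  · exact ⟨1, hs.exists_step_of_leftInput hF hp h⟩
  · exact ⟨2, hs.exists_step_of_product hK hF hp h⟩

theorem step_cases (hs : K.IsCut s) (h : K.Step r s t) :
    (K.IsCoproduct (K.α s.cur) ∧ t.cur = K.σ (K.σ (K.α s.cur))) ∨
      (∃ p c, K.IsProduct p ∧ K.IsCoproduct c ∧ K.α s.cur = K.σ p ∧ t.cur = K.σ c ∧
        K.φ.SameCycle (K.σ p) (K.σ c)) ∨
      K.IsProduct t.cur ∧ K.α s.cur = K.σ (K.σ t.cur) := by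
  cases h with
  | coproduct hr hα cur left right => exact .inl ⟨hα, cur⟩
  | leftInput p hr hp hα left right =>
    obtain ⟨hface, ⟨c, hc, hcur⟩, -⟩ := right ▸ hs.right
    exact .inr (.inl ⟨p, c, hp, hc, hα, hcur, hα ▸ hcur ▸ hface⟩)
  | product hr hp hα left right => exact .inr (.inr ⟨hp, hα⟩)

theorem cur_eq_of_step (hF : K.FaceCorners) (hs : K.IsCut s) (hs' : K.IsCut s')
    (h : K.Step r s t) (h' : K.Step r' s' t') (heq : t.cur = t'.cur) : s.cur = s'.cur := by
  apply K.α.injective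
  rcases hs.step_cases h with ⟨hc, e⟩ | ⟨p, c, hp, hc, hα, e, hf⟩ | ⟨hp, hα⟩ <;>
    rcases hs'.step_cases h' with ⟨hc', e'⟩ | ⟨p', c', hp', hc', hα', e', hf'⟩ | ⟨hp', hα'⟩
  · exact K.σ.injective (K.σ.injective (e.symm.trans (heq.trans e')))
  · exact absurd (e'.symm.trans (heq.symm.trans e)) (hc'.σ_ne_σ_σ hc)
  · exact absurd (heq.symm.trans e) (hp'.ne_σ_σ hc)
  · exact absurd (e.symm.trans (heq.trans e')) (hc.σ_ne_σ_σ hc')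
  · have hcc' : K.σ c = K.σ c' := e.symm.trans (heq.trans e')
    rw [hα, hα', hF.top_unique p p' hp hp' (hf.trans (hcc' ▸ hf'.symm))]
  · exact absurd (heq.symm.trans e) (hp'.ne_σ hc)
  · exact absurd (heq.trans e') (hp.ne_σ_σ hc')
  · exact absurd (heq.trans e') (hp.ne_σ hc')
  · rw [hα, hα', heq]

theorem eq_start_of_cur_eq_root (hF : K.FaceCorners) (hs : K.IsCut s) (h : s.cur = K.root) :
    s = ⟨K.root, [], []⟩ := by
  obtain ⟨o, L, R⟩ := s
  obtain rfl : o = K.root := h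
  rcases R with _ | ⟨r, R⟩
  · rcases L with _ | ⟨x, L⟩
    · rfl
    · obtain ⟨hx, ⟨p, hp, hxp⟩, -⟩ := hs.left
      exact absurd (hxp ▸ hx) (hF.top_left p hp)
  · obtain ⟨hr, ⟨c, hc, rfl⟩, -⟩ := hs.right
    exact absurd hr (hF.bottom_right c hc)

theorem exists_forall_step (hK : K.IsCubic) (hF : K.FaceCorners) :
    ∃ (w : ℕ → Fin 3) (s : ℕ → Scan K), s 0 = ⟨K.root, [], []⟩ ∧ (∀ i, K.IsCut (s i)) ∧
      ∀ i, K.Step (w i) (s i) (s (i + 1)) := by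
  choose r next hnext using fun s : {s // K.IsCut s} => exists_step hK hF s.2
  let s (i : ℕ) : {s // K.IsCut s} := (fun s => ⟨next s, (hnext s).2⟩)^[i] ⟨_, start hK⟩
  refine ⟨fun i => r (s i), fun i => (s i).1, rfl, fun i => (s i).2, fun i => ?_⟩
  have hs : (s (i + 1)).1 = next (s i) := congrArg Subtype.val (Function.iterate_succ_apply' ..)
  simpa only [hs] using (hnext (s i)).1

end IsCut

-- Every cut has a successor and determines its predecessor, so the sequence of cuts is periodic.
theorem IsCubic.exists_reading (hK : K.IsCubic) (hF : K.FaceCorners) (hconn : K.Connected) :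
    ∃ N w s, K.IsReading N w s := by
  obtain ⟨w, s, h0, hcut, hstep⟩ := IsCut.exists_forall_step hK hF
  obtain ⟨N, hN, hcur, hinj⟩ := exists_injOn_period (fun i => (s i).cur) fun i j =>
    (hcut i).cur_eq_of_step hF (hcut j) (hstep i) (hstep j)
  have hsweep : K.IsSweep N w s :=
    ⟨h0, (hcut N).eq_start_of_cur_eq_root hF (hcur.trans (by rw [h0])), fun i _ => hstep i⟩
  exact ⟨N, w, s, hsweep, fun _ => hsweep.exists_cur_eq hK hconn hN, hinj⟩

end RootedData

namespace RootedData

namespace IsReading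

variable {K : RootedData} {N : ℕ} {w : ℕ → Fin 3} {s : ℕ → Scan K}
  (h : K.IsReading N w s) (hK : K.IsCubic) {i : ℕ} {d : K.D}

/-! ## Times and heights -/

/-- The time at which the wire of a half-edge is current. -/
noncomputable def time (d : K.D) : ℕ := (h.exists_cur hK d).choose

theorem time_lt (d : K.D) : h.time hK d < N := (h.exists_cur hK d).choose_spec.1

theorem time_spec (d : K.D) : (s (h.time hK d)).cur = d ∨ K.α (s (h.time hK d)).cur = d :=
  (h.exists_cur hK d).choose_spec.2

theorem cur_time (hd : K.out d = true) : (s (h.time hK d)).cur = d :=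
  (h.time_spec hK d).resolve_right fun hα => by
    simpa [hα, hd] using h.out_α_cur hK (h.time_lt hK d).le

theorem α_cur_time (hd : K.out d = false) : K.α (s (h.time hK d)).cur = d :=
  (h.time_spec hK d).resolve_left fun hc => by
    simpa [hc, hd] using h.out_cur hK (h.time_lt hK d).le

theorem time_cur (hi : i < N) : h.time hK (s i).cur = i :=
  h.inj _ (h.time_lt hK _) _ hi (h.cur_time hK (h.out_cur hK hi.le))

theorem time_α_cur (hi : i < N) : h.time hK (K.α (s i).cur) = i :=
  h.inj _ (h.time_lt hK _) _ hi (K.α.injective (h.α_cur_time hK (h.out_α_cur hK hi.le)))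

theorem time_α (d : K.D) : h.time hK (K.α d) = h.time hK d := by
  obtain ⟨i, hi, rfl | rfl⟩ := h.exists_cur hK d
  · rw [h.time_cur hK hi, h.time_α_cur hK hi]
  · rw [hK.α_α, h.time_cur hK hi, h.time_α_cur hK hi]

theorem time_root : h.time hK K.root = 0 := by
  rw [← h.cur_zero, h.time_cur hK (h.pos hK)]

theorem eq_of_time_eq {e : K.D} (hde : K.out d = K.out e) (ht : h.time hK d = h.time hK e) :
    d = e := by
  cases hd : K.out d
  · rw [← h.α_cur_time hK hd, ht, h.α_cur_time hK (hde.symm.trans hd)]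
  · rw [← h.cur_time hK hd, ht, h.cur_time hK (hde.symm.trans hd)]

/-- The time of an input half-edge, and the junk value `0` for an output. -/
noncomputable def inputTime (d : K.D) : ℕ := if K.out d = true then 0 else h.time hK d

/-- The last time at which an input of the vertex of `d` is current. It increases along the
edges, the root edge excepted. -/
noncomputable def height (d : K.D) : ℕ :=
  max (h.inputTime hK d) (max (h.inputTime hK (K.σ d)) (h.inputTime hK (K.σ (K.σ d))))

theorem height_σ (d : K.D) : h.height hK (K.σ d) = h.height hK d := by
  unfold height
  rw [hK.σ_σ_σ]
  omega

theorem height_eq_of_sameCycle {x y : K.D} (hxy : K.σ.SameCycle x y) :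
    h.height hK x = h.height hK y := by
  rcases eq_or_eq_or_eq_of_sameCycle hK.σ_σ_σ hxy with rfl | rfl | rfl
  · rfl
  · rw [height_σ]
  · rw [height_σ, height_σ]

theorem inputTime_of_out (hd : K.out d = true) : h.inputTime hK d = 0 := by
  simp [inputTime, hd]

theorem inputTime_of_in (hd : K.out d = false) : h.inputTime hK d = h.time hK d := by
  simp [inputTime, hd]

theorem time_le_height (hd : K.out d = false) : h.time hK d ≤ h.height hK d :=
  (h.inputTime_of_in hK hd).symm.trans_le (le_max_left _ _)

theorem height_coproduct (hd : K.IsCoproduct d) : h.height hK d = h.time hK d := by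
  simp [height, h.inputTime_of_in hK hd.out_self, h.inputTime_of_out hK hd.out_σ,
    h.inputTime_of_out hK hd.out_σ_σ]

theorem height_product (hd : K.IsProduct d) :
    h.height hK d = max (h.time hK (K.σ d)) (h.time hK (K.σ (K.σ d))) := by
  simp [height, h.inputTime_of_out hK hd.out_self, h.inputTime_of_in hK hd.out_σ,
    h.inputTime_of_in hK hd.out_σ_σ]

theorem height_cur_succ_le (hi : i < N) : h.height hK (s (i + 1)).cur ≤ i := by
  cases h.step i hi with
  | coproduct hr hα cur left right =>
    rw [cur, height_σ, height_σ, h.height_coproduct hK hα, h.time_α_cur hK hi]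
  | leftInput p hr hp hα left right =>
    obtain ⟨j, hj, hc, hcur, -⟩ := h.exists_push_right hi.le (by rw [right])
    rw [hcur, height_σ, h.height_coproduct hK hc, h.time_α_cur hK (by omega)]
    exact hj.le
  | product hr hp hα left right =>
    obtain ⟨j, hj, hcur, -⟩ := h.exists_push_left hi.le (by rw [left])
    rw [h.height_product hK hp, ← hα, h.time_α_cur hK hi, ← h.time_α hK (K.σ _), ← hcur,
      h.time_cur hK (by omega)]
    exact max_le hj.le le_rfl

theorem height_lt_height_α (hd : K.out d = true) (hroot : d ≠ K.root) :
    h.height hK d < h.height hK (K.α d) := by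
  obtain ⟨i, hi, rfl⟩ := h.surj d hd
  refine lt_of_lt_of_le ?_ (h.time_le_height hK (h.out_α_cur hK hi.le))
  rw [h.time_α_cur hK hi]
  rcases i with _ | i
  · exact absurd h.cur_zero hroot
  · exact Nat.lt_succ_of_le (h.height_cur_succ_le hK (by omega))

/-! ## Labels of faces -/

/-- The label of the face to the left of the current wire: one more than the time of the wire to
the left of this face. Like `rightLabel`, it depends on the face only, see
`label_eq_of_sameCycle`. -/
noncomputable def leftLabel (i : ℕ) : ℕ :=
  ((s i).left.map fun x => h.time hK x + 1).headD 0

/-- The label of the face to the right of the current wire: the time of the wire to the right of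
this face. -/
noncomputable def rightLabel (i : ℕ) : ℕ := ((s i).right.map (h.time hK)).headD (N + 1)

/-- The label of the face to the left of a half-edge. -/
noncomputable def label (d : K.D) : ℕ :=
  if K.out d = true then h.leftLabel hK (h.time hK d) else h.rightLabel hK (h.time hK d)

variable {x : K.D} {L : List K.D}

theorem leftLabel_of_left_eq_nil (hl : (s i).left = []) : h.leftLabel hK i = 0 := by
  simp [leftLabel, hl]

theorem leftLabel_of_left_eq_cons (hl : (s i).left = x :: L) :
    h.leftLabel hK i = h.time hK x + 1 := by
  simp [leftLabel, hl]

theorem leftLabel_congr {j : ℕ} (hij : (s i).left = (s j).left) :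
    h.leftLabel hK i = h.leftLabel hK j := by
  rw [leftLabel, leftLabel, hij]

theorem rightLabel_of_right_eq_nil (hr : (s i).right = []) : h.rightLabel hK i = N + 1 := by
  simp [rightLabel, hr]

theorem rightLabel_of_right_eq_cons (hr : (s i).right = x :: L) :
    h.rightLabel hK i = h.time hK x := by
  simp [rightLabel, hr]

theorem rightLabel_congr {j : ℕ} (hij : (s i).right = (s j).right) :
    h.rightLabel hK i = h.rightLabel hK j := by
  rw [rightLabel, rightLabel, hij]

theorem leftLabel_le (hi : i ≤ N) : h.leftLabel hK i ≤ i := by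
  rcases hl : (s i).left with _ | ⟨x, L⟩
  · simp [h.leftLabel_of_left_eq_nil hK hl]
  · obtain ⟨j, hj, rfl, -⟩ := h.exists_push_left hi (by rw [hl])
    rw [h.leftLabel_of_left_eq_cons hK hl, h.time_cur hK (by omega)]
    exact hj

include h in
theorem succ_lt_of_left_eq_cons (hi : i < N) (hl : (s (i + 1)).left = x :: L) : i + 1 < N :=
  lt_of_le_of_ne hi fun hN => List.cons_ne_nil x L (hl.symm.trans (hN ▸ h.left_last))

theorem lt_rightLabel (hi : i ≤ N) : i < h.rightLabel hK i := by
  rcases hr : (s i).right with _ | ⟨x, R⟩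
  · rw [h.rightLabel_of_right_eq_nil hK hr]
    exact Nat.lt_succ_of_le hi
  · obtain ⟨j, hij, hj, rfl, -, hl⟩ := h.exists_pop_right hi (by rw [hr])
    rw [h.rightLabel_of_right_eq_cons hK hr, h.time_cur hK (h.succ_lt_of_left_eq_cons hj hl)]
    omega

theorem label_cur (hi : i ≤ N) : h.label hK (s i).cur = h.leftLabel hK i := by
  rw [label, if_pos (h.out_cur hK hi)]
  rcases hi.lt_or_eq with hi | rfl
  · rw [h.time_cur hK hi]
  · rw [h.cur_last, time_root, h.leftLabel_congr hK (h.left_zero.trans h.left_last.symm)]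

theorem label_α_cur (hi : i ≤ N) : h.label hK (K.α (s i).cur) = h.rightLabel hK i := by
  rw [label, if_neg (by simp [h.out_α_cur hK hi]), h.time_α]
  rcases hi.lt_or_eq with hi | rfl
  · rw [h.time_cur hK hi]
  · rw [h.cur_last, time_root, h.rightLabel_congr hK (h.right_zero.trans h.right_last.symm)]

theorem label_root : h.label hK K.root = 0 := by
  rw [← h.cur_zero, h.label_cur hK N.zero_le, h.leftLabel_of_left_eq_nil hK h.left_zero]

theorem label_α_root : h.label hK (K.α K.root) = N + 1 := by
  rw [← h.cur_zero, h.label_α_cur hK N.zero_le, h.rightLabel_of_right_eq_nil hK h.right_zero]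

include h hK in
theorem exists_cur_σ_of_coproduct (hd : K.IsCoproduct d) :
    ∃ j, j + 1 < N ∧ (s (j + 1)).cur = K.σ d ∧ (s (j + 1)).left = (s j).cur :: (s j).left ∧
      ∃ i < N, K.α (s i).cur = d ∧ (s (i + 1)).cur = K.σ (K.σ d) ∧
        (s (i + 1)).left = (s i).left ∧ (s (i + 1)).right = K.σ d :: (s (j + 1)).right ∧
        (s (j + 1)).right = (s i).right := by
  obtain ⟨i, hi, hα, -, hcur, hl, hr⟩ := h.exists_step_coproduct hK hd
  obtain ⟨j, -, hj, hcur', hr', hl'⟩ := h.exists_pop_right hi (by rw [hr])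
  exact ⟨j, h.succ_lt_of_left_eq_cons hj hl', hcur', hl', i, hi, hα, hcur, hl, hr' ▸ hr, hr'⟩

include h hK in
theorem exists_α_cur_σ_of_product (hd : K.IsProduct d) :
    ∃ j < N, K.α (s j).cur = K.σ d ∧ (s j).right = (s (j + 1)).cur :: (s (j + 1)).right ∧
      j + 1 < N ∧ ∃ i < N, K.α (s i).cur = K.σ (K.σ d) ∧ (s (i + 1)).cur = d ∧
        (s (i + 1)).right = (s i).right ∧ (s i).left = (s j).cur :: (s j).left ∧
        (s j).left = (s (i + 1)).left := by
  obtain ⟨i, hi, hα, -, hcur, hr, hl⟩ := h.exists_step_product hK hd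
  obtain ⟨j, hj, hcur', hl', hr', -⟩ := h.exists_push_left hi.le (by rw [hl])
  exact ⟨j, by omega, by rw [hcur', hK.α_α], hr', by omega, i, hi, hα, hcur, hr,
    by rw [hl, hcur', hl'], hl'⟩

theorem label_σ_coproduct (hd : K.IsCoproduct d) :
    h.label hK (K.σ d) = h.time hK (K.σ d) ∧ 0 < h.time hK (K.σ d) := by
  obtain ⟨j, hj, hcur, hl, -⟩ := h.exists_cur_σ_of_coproduct hK hd
  rw [← hcur, h.label_cur hK hj.le, h.leftLabel_of_left_eq_cons hK hl, h.time_cur hK (by omega),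
    h.time_cur hK hj]
  exact ⟨rfl, j.succ_pos⟩

theorem label_σ_product (hd : K.IsProduct d) :
    h.label hK (K.σ d) = h.time hK (K.σ d) + 1 := by
  obtain ⟨j, hj, hα, hr, hj', -⟩ := h.exists_α_cur_σ_of_product hK hd
  rw [← hα, h.label_α_cur hK hj.le, h.rightLabel_of_right_eq_cons hK hr, h.time_cur hK hj',
    h.time_α_cur hK hj]

theorem label_coproduct (hd : K.IsCoproduct d) :
    h.label hK (K.σ (K.σ d)) = h.label hK (K.α d) ∧
      h.label hK d = h.label hK (K.α (K.σ d)) ∧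
      h.label hK (K.σ d) = h.label hK (K.α (K.σ (K.σ d))) := by
  obtain ⟨j, hj, hcur, -, i, hi, hα, hcur', hl, hr, hr'⟩ := h.exists_cur_σ_of_coproduct hK hd
  refine ⟨?_, ?_, ?_⟩
  · rw [← hcur', h.label_cur hK hi, ← hα, hK.α_α, h.label_cur hK hi.le, h.leftLabel_congr hK hl]
  · rw [← hcur, h.label_α_cur hK hj.le, ← hα, h.label_α_cur hK hi.le, h.rightLabel_congr hK hr']
  · rw [(h.label_σ_coproduct hK hd).1, ← hcur', h.label_α_cur hK hi,
      h.rightLabel_of_right_eq_cons hK hr]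

theorem label_product (hd : K.IsProduct d) :
    h.label hK (K.σ (K.σ d)) = h.label hK (K.α d) ∧
      h.label hK d = h.label hK (K.α (K.σ d)) ∧
      h.label hK (K.σ d) = h.label hK (K.α (K.σ (K.σ d))) := by
  obtain ⟨j, hj, hα, -, -, i, hi, hα', hcur, hr, hl, hl'⟩ := h.exists_α_cur_σ_of_product hK hd
  refine ⟨?_, ?_, ?_⟩
  · rw [← hα', h.label_α_cur hK hi.le, ← hcur, h.label_α_cur hK hi, h.rightLabel_congr hK hr]
  · rw [← hα, hK.α_α, h.label_cur hK hj.le, ← hcur, h.label_cur hK hi, h.leftLabel_congr hK hl']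
  · rw [h.label_σ_product hK hd, ← hα', hK.α_α, h.label_cur hK hi.le,
      h.leftLabel_of_left_eq_cons hK hl, ← hα, h.time_α]

theorem label_σ_σ (d : K.D) : h.label hK (K.σ (K.σ d)) = h.label hK (K.α d) := by
  rcases hK.cases d with ⟨c, hc, rfl | rfl | rfl⟩ | ⟨p, hp, rfl | rfl | rfl⟩
  · exact (h.label_coproduct hK hc).1
  · exact (congrArg _ (hK.σ_σ_σ _)).trans (h.label_coproduct hK hc).2.1
  · exact (congrArg _ (hK.σ_σ_σ _)).trans (h.label_coproduct hK hc).2.2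
  · exact (h.label_product hK hp).1
  · exact (congrArg _ (hK.σ_σ_σ _)).trans (h.label_product hK hp).2.1
  · exact (congrArg _ (hK.σ_σ_σ _)).trans (h.label_product hK hp).2.2

theorem label_eq_of_sameCycle {y : K.D} (hxy : K.φ.SameCycle x y) :
    h.label hK x = h.label hK y := by
  obtain ⟨i, rfl⟩ := hxy.exists_nat_pow_eq
  clear hxy
  induction i with
  | zero => rfl
  | succ i ih => rw [ih, pow_succ', Perm.mul_apply, hK.φ_apply, h.label_σ_σ hK, hK.α_α]

theorem label_lt_label_α (hd : K.out d = true) : h.label hK d < h.label hK (K.α d) := by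
  obtain ⟨i, hi, rfl⟩ := h.surj d hd
  rw [h.label_cur hK hi.le, h.label_α_cur hK hi.le]
  exact (h.leftLabel_le hK hi.le).trans_lt (h.lt_rightLabel hK hi.le)

end IsReading

end RootedData

theorem card_add_two_le_card {A B : Type*} [Finite B] {f : A → B} {x y : B} (hf : f.Injective)
    (hxy : x ≠ y) (hx : ∀ a, f a ≠ x) (hy : ∀ a, f a ≠ y) : Nat.card A + 2 ≤ Nat.card B := by
  have := Finite.of_injective f hf
  have hinj : (Sum.elim f ![x, y]).Injective :=
    hf.sumElim (by simpa [Function.Injective, Fin.forall_fin_two] using ⟨hxy, hxy.symm⟩)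
      (by simpa [Fin.forall_fin_two] using fun a => ⟨hx a, hy a⟩)
  simpa [Nat.card_sum] using Nat.card_le_card_of_injective _ hinj

namespace RootedData

namespace IsReading

variable {K : RootedData} {N : ℕ} {w : ℕ → Fin 3} {s : ℕ → Scan K}
  (h : K.IsReading N w s) (hK : K.IsCubic)
include h hK

theorem face_root_ne : K.face K.root ≠ K.face (K.α K.root) := fun hF => by
  simpa [h.label_root hK, h.label_α_root hK] using
    h.label_eq_of_sameCycle hK (OMap.face_eq_iff.1 hF)

theorem card_coproducts_add_two_le : Nat.card {c // K.IsCoproduct c} + 2 ≤ K.numFaces := by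
  have hlabel (c : {c // K.IsCoproduct c}) {d} (hF : K.face (K.σ c) = K.face d) :
      h.time hK (K.σ c) = h.label hK d :=
    (h.label_σ_coproduct hK c.2).1.symm.trans (h.label_eq_of_sameCycle hK (OMap.face_eq_iff.1 hF))
  refine card_add_two_le_card (f := fun c : {c // K.IsCoproduct c} => K.face (K.σ c))
    (fun c c' hF => Subtype.ext (K.σ.injective (h.eq_of_time_eq hK ?_ ?_)))
    (h.face_root_ne hK) (fun c hF => ?_) fun c hF => ?_
  · rw [c.2.out_σ, c'.2.out_σ]
  · rw [hlabel c hF, (h.label_σ_coproduct hK c'.2).1]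
  · exact (h.label_σ_coproduct hK c.2).2.ne' ((hlabel c hF).trans (h.label_root hK))
  · have := h.time_lt hK (K.σ c)
    rw [hlabel c hF, h.label_α_root] at this
    omega

theorem card_products_add_two_le : Nat.card {p // K.IsProduct p} + 2 ≤ K.numFaces := by
  have hlabel (p : {p // K.IsProduct p}) {d} (hF : K.face (K.σ p) = K.face d) :
      h.time hK (K.σ p) + 1 = h.label hK d :=
    (h.label_σ_product hK p.2).symm.trans (h.label_eq_of_sameCycle hK (OMap.face_eq_iff.1 hF))
  refine card_add_two_le_card (f := fun p : {p // K.IsProduct p} => K.face (K.σ p))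
    (fun p p' hF => Subtype.ext (K.σ.injective (h.eq_of_time_eq hK ?_ ?_)))
    (h.face_root_ne hK) (fun p hF => ?_) fun p hF => ?_
  · rw [p.2.out_σ, p'.2.out_σ]
  · exact Nat.succ_injective ((hlabel p hF).trans (h.label_σ_product hK p'.2))
  · exact Nat.succ_ne_zero _ ((hlabel p hF).trans (h.label_root hK))
  · have := h.time_lt hK (K.σ p)
    have := (hlabel p hF).trans (h.label_α_root hK)
    omega

end IsReading

end RootedData

namespace RootedData

variable {K K' : RootedData} {N i : ℕ} {w w' : ℕ → Fin 3} {s : ℕ → Scan K} {s' : ℕ → Scan K'}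

/-! ## The word of a reading determines the map -/

namespace IsReading

theorem card_eq (h : K.IsReading N w s) (hK : K.IsCubic) : Nat.card K.D = 2 * N := by
  let e : K.D ≃ Fin N × Bool :=
    { toFun d := (⟨h.time hK d, h.time_lt hK d⟩, K.out d)
      invFun x := if x.2 then (s x.1).cur else K.α (s x.1).cur
      left_inv d := by
        cases hd : K.out d
        · simpa [hd] using h.α_cur_time hK hd
        · simpa [hd] using h.cur_time hK hd
      right_inv := by
        rintro ⟨i, _ | _⟩
        · simp [h.time_α_cur hK i.2, h.out_α_cur hK i.2.le]
        · simp [h.time_cur hK i.2, h.out_cur hK i.2.le] }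
  rw [Nat.card_congr e]
  simp [mul_comm]

variable (h : K.IsReading N w s) (hK : K.IsCubic) (h' : K'.IsReading N w' s') (hK' : K'.IsCubic)

/-- The half-edge of `K'` in the same direction as `d` whose wire has the same time. If two maps
have readings with the same word, then this is an isomorphism. -/
noncomputable def transfer (s' : ℕ → Scan K') (d : K.D) : K'.D :=
  if K.out d = true then (s' (h.time hK d)).cur else K'.α (s' (h.time hK d)).cur

theorem transfer_α_cur (hi : i < N) : h.transfer hK s' (K.α (s i).cur) = K'.α (s' i).cur := by
  rw [transfer, if_neg (by simp [h.out_α_cur hK hi.le]), h.time_α_cur hK hi]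

include h'

theorem transfer_cur (hi : i ≤ N) : h.transfer hK s' (s i).cur = (s' i).cur := by
  rw [transfer, if_pos (h.out_cur hK hi)]
  rcases hi.lt_or_eq with hi | rfl
  · rw [h.time_cur hK hi]
  · rw [h.cur_last, time_root, h'.cur_zero, h'.cur_last]

include hK' in
theorem transfer_α (d : K.D) : h.transfer hK s' (K.α d) = K'.α (h.transfer hK s' d) := by
  obtain ⟨i, hi, rfl | rfl⟩ := h.exists_cur hK d
  · rw [h.transfer_α_cur hK hi, h.transfer_cur hK h' hi.le]
  · rw [h.transfer_α_cur hK hi, hK.α_α, hK'.α_α, h.transfer_cur hK h' hi.le]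

include hK' in
theorem out_transfer (d : K.D) : K'.out (h.transfer hK s' d) = K.out d := by
  obtain ⟨i, hi, rfl | rfl⟩ := h.exists_cur hK d
  · rw [h.transfer_cur hK h' hi.le, h.out_cur hK hi.le, h'.out_cur hK' hi.le]
  · rw [h.transfer_α_cur hK hi, h.out_α_cur hK hi.le, h'.out_α_cur hK' hi.le]

theorem transfer_transfer (d : K.D) : h'.transfer hK' s (h.transfer hK s' d) = d := by
  obtain ⟨i, hi, rfl | rfl⟩ := h.exists_cur hK d
  · rw [h.transfer_cur hK h' hi.le, h'.transfer_cur hK' h hi.le]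
  · rw [h.transfer_α_cur hK hi, h'.transfer_α_cur hK' hi]

variable (hw : ∀ i < N, w i = w' i)
include hw

theorem left_eq_map_transfer (hi : i ≤ N) :
    (s' i).left = (s i).left.map (h.transfer hK s') := by
  induction i with
  | zero => rw [h.left_zero, h'.left_zero, List.map_nil]
  | succ i ih =>
    specialize ih (Nat.le_of_succ_le hi)
    have := hw i hi
    have := h.transfer_cur hK h' (Nat.le_of_succ_le hi)
    cases h.step i hi <;> cases h'.step i hi <;> simp_all

theorem right_eq_map_transfer (hi : i ≤ N) :
    (s' i).right = (s i).right.map (h.transfer hK s') := by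
  induction hi using Nat.decreasingInduction with
  | self => rw [h.right_last, h'.right_last, List.map_nil]
  | of_succ i hi ih =>
    have := hw i hi
    have := h.transfer_cur hK h' hi
    cases h.step i hi <;> cases h'.step i hi <;> simp_all

theorem transfer_σ_of_coproduct {c : K.D} (hc : K.IsCoproduct c) :
    h.transfer hK s' (K.σ c) = K'.σ (h.transfer hK s' c) ∧
      h.transfer hK s' (K.σ (K.σ c)) = K'.σ (K'.σ (h.transfer hK s' c)) := by
  obtain ⟨i, hi, rfl, hwi, hcur, -, hr⟩ := h.exists_step_coproduct hK hc
  cases h'.step i hi with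
  | coproduct hr' hα' cur' left' right' =>
    rw [h.transfer_α_cur hK hi, ← cur', ← hcur, h.transfer_cur hK h' hi]
    rw [h.right_eq_map_transfer hK h' hw hi, hr, List.map_cons] at right'
    exact ⟨(List.cons.inj right').1, rfl⟩
  | leftInput p' hr' _ _ _ _ => exact absurd hr' (by rw [← hw i hi, hwi]; decide)
  | product hr' _ _ _ _ => exact absurd hr' (by rw [← hw i hi, hwi]; decide)

include hK' in
theorem transfer_σ_of_product {p : K.D} (hp : K.IsProduct p) :
    h.transfer hK s' (K.σ p) = K'.σ (h.transfer hK s' p) ∧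
      h.transfer hK s' (K.σ (K.σ p)) = K'.σ (K'.σ (h.transfer hK s' p)) := by
  obtain ⟨i, hi, hα, hwi, rfl, -, hl⟩ := h.exists_step_product hK hp
  cases h'.step i hi with
  | coproduct hr' _ _ _ _ => exact absurd hr' (by rw [← hw i hi, hwi]; decide)
  | leftInput p' hr' _ _ _ _ => exact absurd hr' (by rw [← hw i hi, hwi]; decide)
  | product hr' hp' hα' left' right' =>
    rw [← hα, h.transfer_α_cur hK hi, h.transfer_cur hK h' hi, ← hα']
    rw [h.left_eq_map_transfer hK h' hw hi.le, hl, List.map_cons, h.transfer_α hK h' hK'] at left'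
    exact ⟨K'.α.injective (List.cons.inj left').1, rfl⟩

include hK' in
theorem transfer_σ (d : K.D) : h.transfer hK s' (K.σ d) = K'.σ (h.transfer hK s' d) := by
  rcases hK.cases d with ⟨c, hc, hd⟩ | ⟨p, hp, hd⟩
  · obtain ⟨h1, h2⟩ := h.transfer_σ_of_coproduct hK h' hw hc
    rcases hd with rfl | rfl | rfl
    · exact h1
    · rw [h2, h1]
    · rw [h2, hK.σ_σ_σ, hK'.σ_σ_σ]
  · obtain ⟨h1, h2⟩ := h.transfer_σ_of_product hK h' hK' hw hp
    rcases hd with rfl | rfl | rfl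
    · exact h1
    · rw [h2, h1]
    · rw [h2, hK.σ_σ_σ, hK'.σ_σ_σ]

include h hK hK' in
theorem iso : K.Iso K' :=
  ⟨⟨h.transfer hK s', h'.transfer hK' s, h.transfer_transfer hK h' hK',
      h'.transfer_transfer hK' h hK⟩,
    h.transfer_σ hK h' hK' hw, h.transfer_α hK h' hK', h.out_transfer hK h' hK', by
      simpa [h.cur_zero, h'.cur_zero] using h.transfer_cur hK h' N.zero_le⟩

end IsReading

/-! ## The map determines the word of a reading -/

theorem Step.deterministic {r r' : Fin 3} {s t t' : Scan K} (h : K.Step r s t)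
    (h' : K.Step r' s t') : r = r' ∧ t = t' := by
  obtain ⟨a, l, R⟩ := t
  obtain ⟨a', l', R'⟩ := t'
  cases h with
  | coproduct hr hα cur left right =>
    cases h' with
    | coproduct hr' hα' cur' left' right' => simp_all
    | leftInput p' hr' hp' hα' left' right' => exact absurd hα' (hα.ne_σ hp')
    | product hr' hp' hα' left' right' => exact absurd hα' (hα.ne_σ_σ hp')
  | leftInput p hr hp hα left right =>
    cases h' with
    | coproduct hr' hα' cur' left' right' => exact absurd hα (hα'.ne_σ hp)
    | leftInput p' hr' hp' hα' left' right' => simp_all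
    | product hr' hp' hα' left' right' => exact absurd (hα.symm.trans hα') (hp.σ_ne_σ_σ hp')
  | product hr hp hα left right =>
    cases h' with
    | coproduct hr' hα' cur' left' right' => exact absurd hα (hα'.ne_σ_σ hp)
    | leftInput p' hr' hp' hα' left' right' => exact absurd (hα'.symm.trans hα) (hp'.σ_ne_σ_σ hp)
    | product hr' hp' hα' left' right' => simp_all

theorem IsSweep.word_eq {s' : ℕ → Scan K} (h : K.IsSweep N w s) (h' : K.IsSweep N w' s')
    (hi : i < N) : w i = w' i := by
  have scan_eq : ∀ i ≤ N, s i = s' i := fun i => by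
    induction i with
    | zero => exact fun _ => h.start.trans h'.start.symm
    | succ i ih => exact fun hi => ((ih (by omega) ▸ h.step i hi).deterministic (h'.step i hi)).2
  exact ((scan_eq i hi.le ▸ h.step i hi).deterministic (h'.step i hi)).1

/-- The image of a cut under a bijection of the half-edges. -/
def Scan.map (f : K.D → K'.D) (t : Scan K) : Scan K' :=
  ⟨f t.cur, t.left.map f, t.right.map f⟩

section Iso

variable {f : K.D ≃ K'.D} (hσ : ∀ d, f (K.σ d) = K'.σ (f d)) (hα : ∀ d, f (K.α d) = K'.α (f d))
  (hout : ∀ d, K'.out (f d) = K.out d) {d : K.D}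

include hσ hout

theorem isCoproduct_iff_of_equiv : K'.IsCoproduct (f d) ↔ K.IsCoproduct d := by
  simp [OMap.IsCoproduct, ← hσ, hout]

theorem isProduct_iff_of_equiv : K'.IsProduct (f d) ↔ K.IsProduct d := by
  simp [OMap.IsProduct, ← hσ, hout]

include hα

theorem Step.map {r : Fin 3} {t t' : Scan K} (h : K.Step r t t') :
    K'.Step r (t.map f) (t'.map f) := by
  cases h with
  | coproduct hr hc cur left right =>
    refine .coproduct hr ?_ ?_ ?_ ?_ <;> simp only [Scan.map, ← hσ, ← hα]
    · exact (isCoproduct_iff_of_equiv hσ hout).2 hc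
    · rw [cur]
    · rw [left]
    · rw [right, List.map_cons]
  | leftInput p hr hp hc left right =>
    refine .leftInput (f p) hr ((isProduct_iff_of_equiv hσ hout).2 hp) ?_ ?_ ?_ <;>
      simp only [Scan.map, ← hσ, ← hα]
    · rw [hc]
    · rw [left, List.map_cons]
    · rw [right, List.map_cons]
  | product hr hp hc left right =>
    refine .product hr ((isProduct_iff_of_equiv hσ hout).2 hp) ?_ ?_ ?_ <;>
      simp only [Scan.map, ← hσ, ← hα]
    · rw [hc]
    · rw [left, List.map_cons]
    · rw [right]

theorem IsSweep.map (hroot : f K.root = K'.root) (h : K.IsSweep N w s) :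
    K'.IsSweep N w fun i => (s i).map f where
  start := by simp [h.start, hroot, Scan.map]
  finish := by simp [h.finish, hroot, Scan.map]
  step i hi := (h.step i hi).map hσ hα hout

end Iso

theorem IsSweep.word_eq_of_iso (h : K.IsSweep N w s) (h' : K'.IsSweep N w' s')
    (hiso : K.Iso K') (hi : i < N) : w i = w' i := by
  obtain ⟨f, hσ, hα, hout, hroot⟩ := hiso
  exact (h.map hσ hα hout hroot).word_eq h' hi

/-! ## Rotation -/

variable {d : K.D}

theorem rotate_isCoproduct : K.rotate.IsCoproduct d ↔ K.IsProduct d := by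
  simp only [OMap.IsCoproduct, OMap.IsProduct, rotate, OMap.reverse, Bool.not_eq_true',
    Bool.not_eq_false']
  rfl

theorem rotate_isProduct : K.rotate.IsProduct d ↔ K.IsCoproduct d := by
  simp only [OMap.IsCoproduct, OMap.IsProduct, rotate, OMap.reverse, Bool.not_eq_true',
    Bool.not_eq_false']
  rfl

theorem IsCubic.rotate (hK : K.IsCubic) : K.rotate.IsCubic where
  α_α := hK.α_α
  out_α d := congrArg not (hK.out_α d)
  operators d := by
    obtain ⟨e, hde, he⟩ := hK.operators d
    exact ⟨e, hde, he.symm.imp rotate_isCoproduct.2 rotate_isProduct.2⟩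
  root_product := rotate_isProduct.2 hK.root_coproduct
  root_coproduct := rotate_isCoproduct.2 ((hK.α_α K.root).symm ▸ hK.root_product)

/-- The cut seen after a rotation by 180 degrees: left and right are exchanged, and the lower
half-edge of a wire becomes the upper one. -/
def Scan.rotate (s : Scan K) : Scan K.rotate :=
  ⟨K.α s.cur, s.right.map K.α, s.left.map K.α⟩

theorem Step.rotate (hK : K.IsCubic) {r : Fin 3} {t t' : Scan K} (h : K.Step r t t')
    (ht : ∀ x ∈ t.right, ∃ c, K.IsCoproduct c ∧ x = K.σ c) :
    K.rotate.Step r.rev t'.rotate t.rotate := by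
  have α_cur (u : Scan K) : K.rotate.α u.rotate.cur = u.cur := hK.α_α _
  cases h with
  | coproduct hr hα cur left right =>
    refine .product (by rw [hr]; rfl) (rotate_isProduct.2 hα) ((α_cur t').trans cur) ?_ ?_
    · exact congrArg (List.map K.α) right
    · exact congrArg (List.map K.α) left.symm
  | leftInput p hr hp hα left right =>
    obtain ⟨c, hc, hcur⟩ := ht t'.cur (by simp [right])
    refine .leftInput c (by rw [hr]; rfl) (rotate_isProduct.2 hc) ((α_cur t').trans hcur) ?_ ?_
    · exact congrArg (List.map K.α) right
    · exact congrArg (List.map K.α) left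
  | product hr hp hα left right =>
    refine .coproduct (by rw [hr]; rfl) ?_ ?_ (congrArg (List.map K.α) right.symm) ?_ <;>
      rw [α_cur]
    · exact rotate_isCoproduct.2 hp
    · exact hα
    · change t.left.map K.α = K.σ t'.cur :: t'.left.map K.α
      rw [left, List.map_cons, hK.α_α]

theorem IsReading.eq_of_cur_eq (h : K.IsReading N w s) {j : ℕ} (hi0 : 0 < i) (hi : i ≤ N)
    (hj0 : 0 < j) (hj : j ≤ N) (hij : (s i).cur = (s j).cur) : i = j := by
  have ne_last {k : ℕ} (hk0 : 0 < k) (hk : k < N) : (s k).cur ≠ (s N).cur := fun e =>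
    hk0.ne' (h.inj _ hk _ (by omega) (e.trans (h.cur_last.trans h.cur_zero.symm)))
  rcases hi.lt_or_eq with hi | rfl <;> rcases hj.lt_or_eq with hj | rfl
  · exact h.inj _ hi _ hj hij
  · exact absurd hij (ne_last hi0 hi)
  · exact absurd hij.symm (ne_last hj0 hj)
  · rfl

theorem IsReading.rotate (h : K.IsReading N w s) (hK : K.IsCubic) :
    K.rotate.IsReading N (fun i => (w (N - 1 - i)).rev) fun i => (s (N - i)).rotate where
  start := congrArg Scan.rotate h.finish
  finish := by
    simp only [Nat.sub_self, h.start]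
    rfl
  step i hi := by
    have hstep := h.step (N - 1 - i) (by omega)
    rw [show N - 1 - i + 1 = N - i by omega] at hstep
    rw [show N - (i + 1) = N - 1 - i by omega]
    refine hstep.rotate hK fun x hx => ?_
    obtain ⟨_, _, hL⟩ := List.append_of_mem hx
    obtain ⟨j, -, hc, hx, -⟩ := h.exists_push_right (by omega) ⟨_, hL.symm⟩
    exact ⟨_, hc, hx⟩
  surj (d : K.D) hd := by
    obtain ⟨i, hi, hcur⟩ := h.surj (K.α d) ((hK.out_α d).trans hd)
    rcases i with _ | i
    · refine ⟨0, hi, hK.α_eq_iff.2 ?_⟩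
      rw [Nat.sub_zero, h.cur_last, ← h.cur_zero, hcur]
    · refine ⟨N - (i + 1), by omega, hK.α_eq_iff.2 ?_⟩
      rw [Nat.sub_sub_self hi.le, hcur]
  inj i hi j hj e := by
    have := h.eq_of_cur_eq (by omega) (by omega) (by omega) (by omega) (K.α.injective e)
    omega

end RootedData

/-! ## Closing a prograph -/

namespace OMap

variable {K : OMap} {x y d : K.D}

/-- The relation of belonging to the same connected component. -/
abbrev Linked (K : OMap) : K.D → K.D → Prop :=
  Relation.EqvGen fun a b => b = K.σ a ∨ b = K.α a

theorem linked_σ (d : K.D) : K.Linked d (K.σ d) := .rel _ _ (.inl rfl)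

theorem linked_α (d : K.D) : K.Linked d (K.α d) := .rel _ _ (.inr rfl)

theorem linked_of_sameCycle (h : K.σ.SameCycle x y) : K.Linked x y := by
  obtain ⟨i, rfl⟩ := h.exists_nat_pow_eq
  clear h
  induction i with
  | zero => exact .refl x
  | succ i ih =>
    rw [pow_succ']
    exact ih.trans _ _ _ (linked_σ _)

theorem acyclic_of_lt {f : K.D → ℕ} (hσ : ∀ x y, K.σ.SameCycle x y → f x = f y)
    (hα : ∀ d, K.out d = true → K.α d ≠ d → f d < f (K.α d)) : K.Acyclic := fun x hx => by
  have lt_of_arc (x y) (h : K.Arc x y) : f x < f y := by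
    obtain ⟨d, hd, hne, hx, hy⟩ := h
    exact (hσ _ _ hx).trans_lt ((hα d hd hne).trans_eq (hσ _ _ hy))
  have lt_of_transGen {x y} (h : Relation.TransGen K.Arc x y) : f x < f y := by
    induction h with
    | single h => exact lt_of_arc _ _ h
    | tail _ h ih => exact ih.trans (lt_of_arc _ _ h)
  exact (lt_of_transGen hx).false

end OMap

namespace PrographData

/-- The prograph with its output connected to its input, rooted at the new edge. -/
abbrev closed (M : PrographData) : RootedData where
  toOMap := M.close
  root := M.outLeg

/-- The input and the output are unconnected. -/
structure HasLegs (M : PrographData) : Prop where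
  inLeg : M.α M.inLeg = M.inLeg
  outLeg : M.α M.outLeg = M.outLeg

variable {M : PrographData} {d : M.D}

theorem closed_α_of_ne (hin : d ≠ M.inLeg) (hout : d ≠ M.outLeg) : M.closed.α d = M.α d :=
  congrArg M.α (swap_apply_of_ne_of_ne hin hout)

theorem α_ne_of_isCubic (hK : M.closed.IsCubic) (hin : d ≠ M.inLeg) (hout : d ≠ M.outLeg) :
    M.α d ≠ d :=
  closed_α_of_ne hin hout ▸ hK.α_ne d

theorem sameCycle_closed_α_φ (d : M.D) : M.σ.SameCycle (M.closed.α d) (M.closed.φ d) :=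
  ⟨-1, by rw [zpow_neg_one]; rfl⟩

theorem arc_φ (hK : M.closed.IsCubic) (hin : d ≠ M.inLeg) (hout : d ≠ M.outLeg)
    (hd : M.out d = true) : M.Arc d (M.closed.φ d) :=
  ⟨d, hd, α_ne_of_isCubic hK hin hout, .refl _ _,
    closed_α_of_ne hin hout ▸ sameCycle_closed_α_φ d⟩

namespace HasLegs

variable (hM : M.HasLegs)
include hM

theorem closed_α_outLeg : M.closed.α M.outLeg = M.inLeg :=
  (congrArg M.α (swap_apply_right _ _)).trans hM.inLeg

theorem closed_α_inLeg : M.closed.α M.inLeg = M.outLeg :=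
  (congrArg M.α (swap_apply_left _ _)).trans hM.outLeg

theorem closed_α_closed_α (d : M.D) : M.closed.α (M.closed.α d) = M.α (M.α d) := by
  have hcomm : swap M.inLeg M.outLeg * M.α = M.α * swap M.inLeg M.outLeg := by
    rw [mul_swap_eq_swap_mul, hM.inLeg, hM.outLeg]
  have hsq : M.closed.α * M.closed.α = M.α * M.α := by
    change M.α * swap M.inLeg M.outLeg * (M.α * swap M.inLeg M.outLeg) = _
    rw [mul_assoc, ← mul_assoc (swap _ _) M.α, hcomm, mul_assoc M.α, swap_mul_self, mul_one]
  exact Perm.congr_fun hsq d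

variable (hK : M.closed.IsCubic)
include hK

theorem α_α (d : M.D) : M.α (M.α d) = d :=
  (hM.closed_α_closed_α d).symm.trans (hK.α_α d)

theorem α_ne_iff : M.α d ≠ d ↔ d ≠ M.inLeg ∧ d ≠ M.outLeg :=
  ⟨fun h => ⟨fun e => h (e ▸ hM.inLeg), fun e => h (e ▸ hM.outLeg)⟩,
    fun h => α_ne_of_isCubic hK h.1 h.2⟩

theorem φ_arc (hin : d ≠ M.inLeg) (hout : d ≠ M.outLeg) (hd : M.out d = false) :
    M.Arc (M.closed.φ d) d := by
  have hα := closed_α_of_ne hin hout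
  refine ⟨M.α d, hα ▸ hK.out_α_of_in hd, ?_, hα ▸ (sameCycle_closed_α_φ d).symm, ?_⟩
  · rw [hM.α_α hK]
    exact (α_ne_of_isCubic hK hin hout).symm
  · rw [hM.α_α hK]

theorem bothDirections (hacyc : M.Acyclic) : M.closed.BothDirections := by
  intro d hroot hroot'
  have ne_outLeg {e : M.D} (he : M.closed.φ.SameCycle d e) : e ≠ M.outLeg := fun h =>
    hroot (by rw [h] at he; exact he)
  have ne_inLeg {e : M.D} (he : M.closed.φ.SameCycle d e) : e ≠ M.inLeg := fun h =>
    hroot' (by rw [h, ← hM.closed_α_outLeg] at he; exact he)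
  constructor
  · by_contra! hin
    refine hacyc d (Relation.transGen_swap.1 ?_)
    refine transGen_self_of_forall_sameCycle (f := M.closed.φ) fun e he => ?_
    exact hM.φ_arc hK (ne_inLeg he) (ne_outLeg he) (Bool.eq_false_iff.2 (hin e he))
  · by_contra! hout
    refine hacyc d (transGen_self_of_forall_sameCycle (f := M.closed.φ) fun e he => ?_)
    exact arc_φ hK (ne_inLeg he) (ne_outLeg he) (Bool.not_eq_false _ ▸ hout e he)

end HasLegs

/-! ## PC prographs have a reading -/

namespace IsPCPrograph

variable {n : ℕ} (hM : M.IsPCPrograph n)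
include hM

theorem hasLegs : M.HasLegs :=
  ⟨((hM.inLeg_iff _).2 rfl).1, ((hM.outLeg_iff _).2 rfl).1⟩

theorem isCubic : M.closed.IsCubic where
  α_α d := (hM.hasLegs.closed_α_closed_α d).trans (hM.wellFormed.1 d)
  out_α d := by
    have hin : M.out M.inLeg = false := hM.inLeg_coproduct.out_self
    have hout : M.out M.outLeg = true := hM.outLeg_product.out_self
    change M.out (M.closed.α d) = !(M.out d)
    by_cases h1 : d = M.inLeg
    · rw [h1, hM.hasLegs.closed_α_inLeg, hin, hout, Bool.not_false]
    by_cases h2 : d = M.outLeg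
    · rw [h2, hM.hasLegs.closed_α_outLeg, hin, hout, Bool.not_true]
    rw [closed_α_of_ne h1 h2]
    refine hM.wellFormed.2 d fun hα => ?_
    cases hd : M.out d
    · exact h1 ((hM.inLeg_iff d).1 ⟨hα, hd⟩)
    · exact h2 ((hM.outLeg_iff d).1 ⟨hα, hd⟩)
  operators := hM.operators
  root_product := hM.outLeg_product
  root_coproduct := hM.hasLegs.closed_α_outLeg.symm ▸ hM.inLeg_coproduct

theorem connected_closed : M.closed.Connected := fun x y => by
  refine Setoid.eqvGen_le (s := Relation.EqvGen.setoid _) (fun x y hxy => ?_) (hM.connected x y)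
  rcases hxy with rfl | rfl
  · exact OMap.linked_σ (K := M.close) x
  by_cases hin : x = M.inLeg
  · rw [hin, hM.hasLegs.inLeg]
    exact .refl _
  by_cases hout : x = M.outLeg
  · rw [hout, hM.hasLegs.outLeg]
    exact .refl _
  exact closed_α_of_ne hin hout ▸ OMap.linked_α (K := M.close) x

theorem bothDirections : M.closed.BothDirections :=
  hM.hasLegs.bothDirections hM.isCubic hM.acyclic

theorem card_eq : Nat.card M.D = 6 * n := by
  have hV : Nat.card M.D = 3 * M.numVertices := hM.isCubic.card_eq_three_mul_numVertices
  have := hM.size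
  omega

theorem exists_reading : ∃ w s, M.closed.IsReading (3 * n) w s := by
  have hcard : Nat.card M.closed.D = 6 * n := hM.card_eq
  have hE := hM.isCubic.card_eq_two_mul_numEdges
  have hV : M.closed.numVertices = 2 * n := hM.size
  have hF : M.closed.numVertices + M.closed.numFaces = M.closed.numEdges + 2 := hM.planar
  obtain ⟨N, w, s, h⟩ := hM.isCubic.exists_reading
    (hM.isCubic.faceCorners hM.bothDirections hV (n := n) (by omega)) hM.connected_closed
  have hN := h.card_eq hM.isCubic
  obtain rfl : N = 3 * n := by omega
  exact ⟨w, s, h⟩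

end IsPCPrograph

end PrographData

/-! ## Maps with a reading -/

namespace RootedData

variable {K : RootedData} {n N : ℕ} {w : ℕ → Fin 3} {s : ℕ → Scan K} {d : K.D}

theorem IsCubic.exists_input (hK : K.IsCubic) (d : K.D) :
    ∃ e, K.σ.SameCycle d e ∧ K.out e = false := by
  obtain ⟨e, hde, he | he⟩ := hK.operators d
  · exact ⟨e, hde, he.out_self⟩
  · exact ⟨K.σ e, hde.trans (sameCycle_self_apply _ _), he.out_σ⟩

theorem IsReading.numFaces_eq (h : K.IsReading N w s) (hK : K.IsCubic) (hb : K.BothDirections)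
    (hn : Nat.card K.D = 6 * n) : K.numFaces = n + 2 := by
  have := h.card_coproducts_add_two_le hK
  have := h.card_products_add_two_le hK
  have := hK.numFaces_le_coproducts hb
  have := hK.numFaces_le_products hb
  have := hK.card_operators
  have := hK.card_eq_three_mul_numVertices
  omega

end RootedData

namespace PrographData

variable {M : PrographData} {n N : ℕ} {w : ℕ → Fin 3} {s : ℕ → RootedData.Scan M.closed}
  (hM : M.HasLegs) (hK : M.closed.IsCubic) (h : M.closed.IsReading N w s)
include hM hK h

theorem acyclic_of_reading : M.Acyclic :=
  OMap.acyclic_of_lt (K := M.toOMap) (fun _ _ => h.height_eq_of_sameCycle hK) fun d hd hα => by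
    obtain ⟨hin, hout⟩ := (hM.α_ne_iff hK).1 hα
    rw [← closed_α_of_ne hin hout]
    exact h.height_lt_height_α hK hd hout

theorem linked_inLeg_of_reading (d : M.D) : M.Linked M.inLeg d := by
  induction hm : h.height hK d using Nat.strong_induction_on generalizing d with | _ m ih
  obtain ⟨e, hde, he⟩ := hK.exists_input d
  refine Relation.EqvGen.trans _ e _ ?_ (OMap.linked_of_sameCycle hde.symm)
  rw [h.height_eq_of_sameCycle hK hde] at hm
  by_cases hin : e = M.inLeg
  · exact hin ▸ .refl _
  have hout : e ≠ M.outLeg := fun h =>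
    Bool.false_ne_true (he.symm.trans ((congrArg M.out h).trans hK.root_product.out_self))
  have hα := closed_α_of_ne hin hout
  have hlt : h.height hK (M.α e) < m := by
    rw [← hm, ← hα]
    have := h.height_lt_height_α hK (hK.out_α_of_in he) fun hroot =>
      hin ((hK.α_eq_iff.1 hroot).trans hM.closed_α_outLeg)
    rwa [hK.α_α] at this
  exact (ih _ hlt _ rfl).trans _ _ _ (.symm _ _ (OMap.linked_α (K := M.toOMap) e))

theorem isPCPrograph_of_reading (hn : Nat.card M.D = 6 * n) : M.IsPCPrograph n := by
  have hin : M.out M.inLeg = false :=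
    (congrArg M.out hM.closed_α_outLeg).symm.trans hK.root_coproduct.out_self
  have hout : M.out M.outLeg = true := hK.root_product.out_self
  have dangling {d : M.D} (hd : M.α d = d) : d = M.inLeg ∨ d = M.outLeg := by
    by_contra! hne
    exact (hM.α_ne_iff hK).2 hne hd
  have hacyc := acyclic_of_reading hM hK h
  have hV : Nat.card M.D = 3 * M.numVertices := hK.card_eq_three_mul_numVertices
  exact {
    wellFormed := ⟨hM.α_α hK, fun d hd => by
      obtain ⟨hin, hout⟩ := (hM.α_ne_iff hK).1 hd
      exact closed_α_of_ne hin hout ▸ hK.out_α d⟩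
    operators := hK.operators
    inLeg_iff := fun d =>
      ⟨fun hd => (dangling hd.1).resolve_right fun e => by simp [e, hout] at hd,
        fun e => e ▸ ⟨hM.inLeg, hin⟩⟩
    outLeg_iff := fun d =>
      ⟨fun hd => (dangling hd.1).resolve_left fun e => by simp [e, hin] at hd,
        fun e => e ▸ ⟨hM.outLeg, hout⟩⟩
    inLeg_coproduct := hM.closed_α_outLeg ▸ hK.root_coproduct
    outLeg_product := hK.root_product
    connected := fun x y =>
      .trans _ _ _ (.symm _ _ (linked_inLeg_of_reading hM hK h x))
        (linked_inLeg_of_reading hM hK h y)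
    acyclic := hacyc
    planar := by
      have hF : M.close.numFaces = n + 2 :=
        h.numFaces_eq hK (hM.bothDirections hK hacyc) hn
      have hE : Nat.card M.D = 2 * M.close.numEdges := hK.card_eq_two_mul_numEdges
      change M.numVertices + M.close.numFaces = M.close.numEdges + 2
      omega
    size := by omega }

end PrographData

/-! ## The dual of a map with a reading -/

namespace RootedData

/-- The dual map, rooted at the edge dual to the root edge. -/
abbrev dual (K : RootedData) : RootedData where
  toOMap := K.toOMap.dual
  root := K.root

variable {K : RootedData} {n N : ℕ} {w : ℕ → Fin 3} {s : ℕ → Scan K} {d : K.D}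

namespace BothDirections

variable (hb : K.BothDirections) (hK : K.IsCubic)
include hb hK

theorem sameCycle_root_of_forall_out (hd : ∀ e, K.φ.SameCycle d e → K.out e = true) :
    K.φ.SameCycle K.root d := by
  by_contra hroot
  obtain ⟨-, e, he, heo⟩ := hb d (fun h => hroot h.symm) fun h => by
    simpa [hK.root_coproduct.out_self] using hd _ h
  simp [hd e he] at heo

theorem sameCycle_α_root_of_forall_in (hd : ∀ e, K.φ.SameCycle d e → K.out e = false) :
    K.φ.SameCycle (K.α K.root) d := by
  by_contra hroot
  obtain ⟨⟨e, he, heo⟩, -⟩ := hb d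
    (fun h => by simpa [hK.root_product.out_self] using hd _ h) fun h => hroot h.symm
  simp [hd e he] at heo

end BothDirections

namespace IsReading

variable (h : K.IsReading N w s) (hK : K.IsCubic)
include h hK

theorem out_of_sameCycle_root (hd : K.φ.SameCycle K.root d) : K.out d = true := by
  by_contra hin
  have := h.label_lt_label_α hK (hK.out_α_of_in (Bool.eq_false_iff.2 hin))
  rw [hK.α_α, ← h.label_eq_of_sameCycle hK hd, h.label_root] at this
  omega

theorem out_of_sameCycle_α_root (hd : K.φ.SameCycle (K.α K.root) d) : K.out d = false := by
  by_contra hout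
  obtain ⟨i, hi, rfl⟩ := h.surj d (Bool.not_eq_false _ ▸ hout)
  have := h.leftLabel_le hK hi.le
  rw [← h.label_cur hK hi.le, ← h.label_eq_of_sameCycle hK hd, h.label_α_root] at this
  omega

end IsReading

namespace IsCubic

variable (hK : K.IsCubic)
include hK

theorem dual_φ_apply (d : K.D) : K.dual.φ d = K.α (K.σ (K.α d)) := by
  change K.φ⁻¹ (K.α d) = _
  rw [Perm.inv_eq_iff_eq, hK.φ_apply, hK.α_α, hK.σ_σ_σ]

theorem dual_φ_ne (d : K.D) : K.dual.φ d ≠ d := by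
  rw [hK.dual_φ_apply]
  exact fun h => hK.σ_ne _ (hK.α_eq_iff.1 h)

theorem dual_φ_φ_φ (d : K.D) : K.dual.φ (K.dual.φ (K.dual.φ d)) = d := by
  simp only [hK.dual_φ_apply, hK.α_α, hK.σ_σ_σ]
  rfl

theorem card_eq_three_mul_numFaces_dual : Nat.card K.D = 3 * K.dual.numFaces :=
  card_eq_prime_mul_card_cycles Nat.prime_three
    (Perm.ext hK.dual_φ_φ_φ) hK.dual_φ_ne

theorem connected_dual (hconn : K.Connected) : K.dual.Connected := fun x y => by
  have linked_dual_σ (x : K.D) : K.dual.Linked x (K.σ x) := by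
    have hφ : K.dual.Linked (K.α (K.σ x)) (K.φ (K.α (K.σ x))) :=
      OMap.linked_σ (K := K.dual.toOMap) _
    rw [hK.φ_apply, hK.α_α, hK.σ_σ_σ] at hφ
    exact .symm _ _ (.trans _ _ _ (OMap.linked_α (K := K.dual.toOMap) (K.σ x)) hφ)
  refine Setoid.eqvGen_le (s := Relation.EqvGen.setoid _) (fun x y hxy => ?_) (hconn x y)
  rcases hxy with rfl | rfl
  · exact linked_dual_σ x
  · exact OMap.linked_α (K := K.dual.toOMap) x

end IsCubic

theorem IsReading.isBipolarTriangulation_dual (h : K.IsReading N w s) (hK : K.IsCubic)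
    (hb : K.BothDirections) (hconn : K.Connected) (hn : Nat.card K.D = 6 * n) :
    K.dual.IsBipolarTriangulation n where
  wellFormed := ⟨hK.α_α, fun d _ => hK.out_α d⟩
  no_dangling := hK.α_ne
  connected := hK.connected_dual hconn
  spherical := by
    have hF := h.numFaces_eq hK hb hn
    have hE := hK.card_eq_two_mul_numEdges
    have hD := hK.card_eq_three_mul_numFaces_dual
    change K.numFaces + K.dual.numFaces = K.numEdges + 2
    omega
  triangles d := ⟨hK.dual_φ_ne d, hK.dual_φ_φ_φ d⟩
  acyclic := OMap.acyclic_of_lt (K := K.dual.toOMap) (fun _ _ => h.label_eq_of_sameCycle hK)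
    fun _ hd _ => h.label_lt_label_α hK hd
  source _ := ⟨hb.sameCycle_root_of_forall_out hK,
    fun hd _ he => h.out_of_sameCycle_root hK (hd.trans he)⟩
  sink _ := ⟨hb.sameCycle_α_root_of_forall_in hK,
    fun hd _ he => h.out_of_sameCycle_α_root hK (hd.trans he)⟩
  size := by
    have hD := hK.card_eq_three_mul_numFaces_dual
    omega

end RootedData

theorem PrographData.IsPCPrograph.isBipolarTriangulation_dual {M : PrographData} {n : ℕ}
    (hM : M.IsPCPrograph n) : M.dual.IsBipolarTriangulation n := by
  obtain ⟨w, s, h⟩ := hM.exists_reading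
  exact h.isBipolarTriangulation_dual hM.isCubic hM.bothDirections hM.connected_closed hM.card_eq

/-! ## Gluing operators together -/

theorem mul_swap_apply_left {A : Type*} [DecidableEq A] {g : Perm A} {a b : A} (hb : g b = b) :
    (g * swap a b) a = b := by
  rw [Perm.mul_apply, swap_apply_left, hb]

theorem mul_swap_apply_right {A : Type*} [DecidableEq A] {g : Perm A} {a b : A} (ha : g a = a) :
    (g * swap a b) b = a := by
  rw [Perm.mul_apply, swap_apply_right, ha]

theorem mul_swap_apply_of_ne {A : Type*} [DecidableEq A] {g : Perm A} {a b x : A} (ha : x ≠ a)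
    (hb : x ≠ b) : (g * swap a b) x = g x := by
  rw [Perm.mul_apply, swap_apply_of_ne_of_ne ha hb]

section Glued

variable {n : ℕ} {g : Perm (Half n)} {a b d x : Half n}

/-- The directions of the half-edges of coproducts and products. -/
def Half.out : Half n → Bool := fun d => match d with
  | (Sum.inl _, s) => s != 0
  | (Sum.inr _, s) => s == 0

theorem Half.exists_of_out (hd : d.out = true) :
    ∃ k, d = copLeft k ∨ d = copRight k ∨ d = prodOut k := by
  obtain ⟨k | k, i⟩ := d <;> refine ⟨k, ?_⟩ <;> revert hd <;> fin_cases i <;>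
    simp [Half.out, copLeft, copRight, prodOut]

theorem fst_eq_inl_iff {k : Fin n} :
    d.1 = .inl k ↔ d = copIn k ∨ d = copRight k ∨ d = copLeft k := by
  obtain ⟨x, i⟩ := d
  fin_cases i <;> simp [copIn, copLeft, copRight]

theorem fst_eq_inr_iff {k : Fin n} :
    d.1 = .inr k ↔ d = prodOut k ∨ d = prodLeft k ∨ d = prodRight k := by
  obtain ⟨x, i⟩ := d
  fin_cases i <;> simp [prodOut, prodLeft, prodRight]

/-- `g` connects some pairs of half-edges of opposite directions. -/
structure IsMatching (g : Perm (Half n)) : Prop where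
  apply_apply : ∀ x, g (g x) = x
  out_apply : ∀ x, g x ≠ x → (g x).out = !x.out

namespace IsMatching

variable (h : IsMatching g) (ha : g a = a) (hb : g b = b) (hab : b.out = !a.out)
include h ha hb hab

theorem mul_swap : IsMatching (g * swap a b) := by
  refine ⟨fun x => ?_, fun x => ?_⟩ <;>
    rcases eq_or_ne x a with rfl | h1
  · rw [mul_swap_apply_left hb, mul_swap_apply_right ha]
  · rcases eq_or_ne x b with rfl | h2
    · rw [mul_swap_apply_right ha, mul_swap_apply_left hb]
    · have h3 : g x ≠ a := fun e => h1 (by rw [← h.apply_apply x, e, ha])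
      have h4 : g x ≠ b := fun e => h2 (by rw [← h.apply_apply x, e, hb])
      rw [mul_swap_apply_of_ne h1 h2, mul_swap_apply_of_ne h3 h4, h.apply_apply]
  · rw [mul_swap_apply_left hb, hab]
    exact fun _ => rfl
  · rcases eq_or_ne x b with rfl | h2
    · rw [mul_swap_apply_right ha, hab, Bool.not_not]
      exact fun _ => rfl
    · rw [mul_swap_apply_of_ne h1 h2]
      exact h.out_apply x

omit h in
theorem mul_swap_apply_eq_self_iff : (g * swap a b) x = x ↔ g x = x ∧ x ≠ a ∧ x ≠ b := by
  have hne : a ≠ b := by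
    rintro rfl
    simp at hab
  rcases eq_or_ne x a with rfl | h1
  · simp [mul_swap_apply_left hb, hne.symm]
  rcases eq_or_ne x b with rfl | h2
  · simp [mul_swap_apply_right ha, hne]
  simp [mul_swap_apply_of_ne h1 h2, h1, h2]

end IsMatching

variable [NeZero n]

/-- Coproducts and products glued along a permutation. -/
abbrev glued (g : Perm (Half n)) : PrographData where
  D := Half n
  σ := (Equiv.refl _).prodCongr (Equiv.addRight 1)
  α := g
  out := Half.out
  inLeg := copIn 0
  outLeg := prodOut (Fin.rev 0)

theorem isCoproduct_glued (k : Fin n) : (glued g).IsCoproduct (copIn k) :=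
  ⟨Prod.ext rfl (by simp [copIn]), rfl, rfl, rfl, by simp [copIn]⟩

theorem isProduct_glued (k : Fin n) : (glued g).IsProduct (prodOut k) :=
  ⟨Prod.ext rfl (by simp [prodOut]), rfl, rfl, rfl, by simp [prodOut]⟩

theorem exists_operator_glued (d : Half n) : ∃ e, (glued g).σ.SameCycle d e ∧
    ((glued g).IsCoproduct e ∨ (glued g).IsProduct e) := by
  have sameCycle_zero (x : Fin n ⊕ Fin n) (i : Fin 3) :
      (glued g).σ.SameCycle (x, i) (x, 0) := by
    fin_cases i
    · exact .refl _ _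
    · exact (sameCycle_self_apply (glued g).σ (x, 0)).symm
    · exact sameCycle_self_apply (glued g).σ (x, 2)
  obtain ⟨k | k, i⟩ := d
  · exact ⟨copIn k, sameCycle_zero _ i, .inl (isCoproduct_glued k)⟩
  · exact ⟨prodOut k, sameCycle_zero _ i, .inr (isProduct_glued k)⟩

theorem card_glued : Nat.card (glued g).D = 6 * n := by
  simp
  omega

/-! ## Partial gluings -/

/-- The operators in `F` are unused. The other ones are glued along `g`, and only their outputs
listed in `l` and the global input `copIn 0` are left unconnected. -/
structure IsGluing (F : Set (Fin n ⊕ Fin n)) (l : List (Half n)) (g : Perm (Half n)) : Prop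
    extends IsMatching g where
  nodup : l.Nodup
  out_of_mem : ∀ x ∈ l, x.out = true
  notMem_of_mem : ∀ x ∈ l, x.1 ∉ F
  zero_notMem : .inl 0 ∉ F
  apply_eq_self_iff : ∀ x, g x = x ↔ x ∈ l ∨ x.1 ∈ F ∨ x = copIn 0

namespace IsGluing

variable {F : Set (Fin n ⊕ Fin n)} {l l' : List (Half n)} {o y : Half n} {k : Fin n}

theorem initial : IsGluing {x : Fin n ⊕ Fin n | x ≠ .inl 0} [copLeft 0, copRight 0] 1 where
  apply_apply _ := rfl
  out_apply x hx := absurd rfl hx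
  nodup := by simp [copLeft, copRight]
  out_of_mem := by simp [Half.out, copLeft, copRight]
  notMem_of_mem := by simp [copLeft, copRight]
  zero_notMem := by simp
  apply_eq_self_iff x := by
    have := fst_eq_inl_iff (d := x) (k := 0)
    simp only [Perm.one_apply, List.mem_cons, List.not_mem_nil, Set.mem_ofPred_eq]
    tauto

theorem of_perm (h : IsGluing F l g) (hl : l.Perm l') : IsGluing F l' g where
  toIsMatching := h.toIsMatching
  nodup := hl.nodup_iff.1 h.nodup
  out_of_mem x hx := h.out_of_mem x (hl.mem_iff.2 hx)
  notMem_of_mem x hx := h.notMem_of_mem x (hl.mem_iff.2 hx)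
  zero_notMem := h.zero_notMem
  apply_eq_self_iff x := by rw [h.apply_eq_self_iff, hl.mem_iff]

theorem apply_of_mem (h : IsGluing F l g) (hx : x ∈ l) : g x = x :=
  (h.apply_eq_self_iff x).2 (.inl hx)

theorem apply_of_fst_mem (h : IsGluing F l g) (hx : x.1 ∈ F) : g x = x :=
  (h.apply_eq_self_iff x).2 (.inr (.inl hx))

theorem ne_head (h : IsGluing F (o :: l) g) (hx : x ∈ l ∨ x.1 ∈ F ∨ x = copIn 0) : x ≠ o := by
  rintro rfl
  rcases hx with hx | hx | rfl
  · exact (List.nodup_cons.1 h.nodup).1 hx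
  · exact h.notMem_of_mem x List.mem_cons_self hx
  · exact absurd (h.out_of_mem _ List.mem_cons_self) (by simp [Half.out, copIn])

theorem fst_ne_of_mem {v : Fin n ⊕ Fin n} (h : IsGluing F l g) (hv : v ∈ F) (hx : x ∈ l) :
    x.1 ≠ v :=
  fun e => h.notMem_of_mem x hx (e ▸ hv)

theorem coproduct (h : IsGluing F (o :: l) g) (hk : .inl k ∈ F) :
    IsGluing (F \ {.inl k}) (copLeft k :: copRight k :: l) (g * swap o (copIn k)) := by
  have ho := h.apply_of_mem List.mem_cons_self
  have hcop : g (copIn k) = copIn k := h.apply_of_fst_mem hk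
  have hdir : (copIn k).out = !o.out := by
    rw [h.out_of_mem o List.mem_cons_self]
    rfl
  have hk0 : copIn k ≠ copIn 0 := fun e => h.zero_notMem (show (copIn 0).1 ∈ F from e ▸ hk)
  have hnew : ∀ j, (.inl k, j) ∉ l := fun j hj =>
    h.fst_ne_of_mem hk (List.mem_cons_of_mem _ hj) rfl
  refine ⟨h.toIsMatching.mul_swap ho hcop hdir, ?_, ?_, ?_, fun hF => h.zero_notMem hF.1,
    fun x => ?_⟩
  · exact List.nodup_cons.2 ⟨by simp [copLeft, copRight, hnew],
      List.nodup_cons.2 ⟨hnew _, (List.nodup_cons.1 h.nodup).2⟩⟩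
  · exact List.forall_mem_cons.2 ⟨rfl, List.forall_mem_cons.2
      ⟨rfl, (List.forall_mem_cons.1 h.out_of_mem).2⟩⟩
  · exact List.forall_mem_cons.2 ⟨fun hF => hF.2 rfl, List.forall_mem_cons.2
      ⟨fun hF => hF.2 rfl, fun x hx hF => h.notMem_of_mem x (List.mem_cons_of_mem _ hx) hF.1⟩⟩
  · rw [IsMatching.mul_swap_apply_eq_self_iff ho hcop hdir, h.apply_eq_self_iff]
    have hne := h.ne_head (x := x)
    have hcases := fst_eq_inl_iff (d := x) (k := k)
    have hin : copIn k ≠ copLeft k ∧ copIn k ≠ copRight k := by simp [copIn, copLeft, copRight]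
    simp only [List.mem_cons, Set.mem_sdiff, Set.mem_singleton_iff]
    grind

theorem product (h : IsGluing F (o :: y :: l) g) (hk : .inr k ∈ F) :
    IsGluing (F \ {.inr k}) (prodOut k :: l)
      (g * swap y (prodLeft k) * swap o (prodRight k)) := by
  have hfix : ∀ j, g (.inr k, j) = (.inr k, j) := fun j => h.apply_of_fst_mem hk
  have hnew : ∀ j, (.inr k, j) ∉ o :: y :: l := fun j hj => h.fst_ne_of_mem hk hj rfl
  simp only [List.mem_cons, not_or] at hnew
  have hout : o.out = true ∧ y.out = true ∧ ∀ x ∈ l, x.out = true := by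
    simpa only [List.forall_mem_cons] using h.out_of_mem
  have hnodup : (o ≠ y ∧ o ∉ l) ∧ y ∉ l ∧ l.Nodup := by
    simpa only [List.nodup_cons, List.mem_cons, not_or] using h.nodup
  have hy := h.apply_of_mem (List.mem_cons_of_mem _ List.mem_cons_self)
  have hdir_y : (prodLeft k).out = !y.out := by rw [hout.2.1]; rfl
  have hdir_o : (prodRight k).out = !o.out := by rw [hout.1]; rfl
  have hfix_y {x} :=
    IsMatching.mul_swap_apply_eq_self_iff (x := x) (b := prodLeft k) hy (hfix 1) hdir_y
  have ho : (g * swap y (prodLeft k)) o = o :=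
    hfix_y.2 ⟨h.apply_of_mem List.mem_cons_self, hnodup.1.1, Ne.symm (hnew 1).1⟩
  have hright : (g * swap y (prodLeft k)) (prodRight k) = prodRight k :=
    hfix_y.2 ⟨hfix 2, (hnew 2).2.1, by simp [prodLeft, prodRight]⟩
  refine ⟨(h.toIsMatching.mul_swap hy (hfix 1) hdir_y).mul_swap ho hright hdir_o,
    List.nodup_cons.2 ⟨(hnew 0).2.2, hnodup.2.2⟩, List.forall_mem_cons.2 ⟨rfl, hout.2.2⟩,
    List.forall_mem_cons.2 ⟨fun hF => hF.2 rfl, fun x hx hF =>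
      h.notMem_of_mem x (List.mem_cons_of_mem _ (List.mem_cons_of_mem _ hx)) hF.1⟩,
    fun hF => h.zero_notMem hF.1, fun x => ?_⟩
  rw [IsMatching.mul_swap_apply_eq_self_iff ho hright hdir_o, hfix_y, h.apply_eq_self_iff]
  have hne_o := h.ne_head (x := x)
  have hne_y := (h.of_perm (.swap y o l)).ne_head (x := x)
  have hcases := fst_eq_inr_iff (d := x) (k := k)
  have hz : (copIn (0 : Fin n)).1 ≠ .inr k := Sum.inl_ne_inr
  have hin : prodLeft k ≠ prodOut k ∧ prodRight k ≠ prodOut k := by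
    simp [prodLeft, prodRight, prodOut]
  have hl : prodLeft k ∉ l ∧ prodRight k ∉ l := ⟨(hnew 1).2.2, (hnew 2).2.2⟩
  clear hfix hfix_y hnew hdir_y hdir_o hout
  simp only [List.mem_cons, Set.mem_sdiff, Set.mem_singleton_iff] at hne_o hne_y ⊢
  grind

theorem coproduct_apply (h : IsGluing F l g) (hk : .inl k ∈ F) :
    (g * swap o (copIn k)) o = copIn k :=
  mul_swap_apply_left (h.apply_of_fst_mem hk)

theorem product_apply_left (h : IsGluing F (o :: y :: l) g) (hk : .inr k ∈ F) :
    (g * swap y (prodLeft k) * swap o (prodRight k)) y = prodLeft k := by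
  have hyo : y ≠ o := h.ne_head (.inl List.mem_cons_self)
  have hy : y ≠ prodRight k := fun e =>
    h.fst_ne_of_mem hk (List.mem_cons_of_mem _ List.mem_cons_self) (congrArg Prod.fst e)
  rw [mul_swap_apply_of_ne hyo hy, mul_swap_apply_left (h.apply_of_fst_mem hk)]

theorem product_apply_right (h : IsGluing F (o :: y :: l) g) (hk : .inr k ∈ F) :
    (g * swap y (prodLeft k) * swap o (prodRight k)) o = prodRight k := by
  have hy : prodRight k ≠ y := fun e =>
    h.fst_ne_of_mem hk (List.mem_cons_of_mem _ List.mem_cons_self) (congrArg Prod.fst e.symm)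
  refine mul_swap_apply_left ?_
  rw [mul_swap_apply_of_ne hy (by simp [prodLeft, prodRight]), h.apply_of_fst_mem hk]

end IsGluing

end Glued

/-! ## Words of tableaux -/

theorem fin_three_cases : ∀ r : Fin 3, r = 0 ∨ r = 1 ∨ r = 2 := by decide

/-- The number of letters `r` among the first `i` letters of the word `w`. -/
def letterCount (w : ℕ → Fin 3) (r : Fin 3) (i : ℕ) : ℕ := Nat.count (fun j => w j = r) i

theorem letterCount_succ (w : ℕ → Fin 3) (r : Fin 3) (i : ℕ) :
    letterCount w r (i + 1) = letterCount w r i + if w i = r then 1 else 0 :=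
  Nat.count_succ _ i

theorem sum_letterCount (w : ℕ → Fin 3) (i : ℕ) :
    letterCount w 0 i + letterCount w 1 i + letterCount w 2 i = i := by
  induction i with
  | zero => simp [letterCount]
  | succ i ih =>
    obtain hw | hw | hw := fin_three_cases (w i) <;> simp [letterCount_succ, hw] <;> omega

namespace Tableau

variable {n : ℕ} (T : Tableau n)

/-- The rows of the entries, read in increasing order; the letters beyond `3 * n` are `0`. -/
def word (i : ℕ) : Fin 3 := if h : i < 3 * n then (T.entry.symm ⟨i, h⟩).1 else 0

variable {T} {T' : Tableau n} {r r' : Fin 3} {k : Fin n} {i : ℕ}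

theorem word_entry (r : Fin 3) (k : Fin n) : T.word (T.entry (r, k)) = r := by
  simp [word]

theorem exists_entry_eq (hi : i < 3 * n) : ∃ r k, i = (T.entry (r, k) : ℕ) :=
  ⟨(T.entry.symm ⟨i, hi⟩).1, (T.entry.symm ⟨i, hi⟩).2, by simp⟩

theorem entry_inj {x y : Fin 3 × Fin n} : (T.entry x : ℕ) = T.entry y ↔ x = y :=
  Fin.val_inj.trans T.entry.injective.eq_iff

theorem letterCount_word (hi : i ≤ 3 * n) :
    letterCount T.word r i = (Finset.univ.filter fun k => (T.entry (r, k) : ℕ) < i).card := by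
  rw [letterCount, Nat.count_eq_card_filter_range]
  symm
  refine Finset.card_bij (fun k _ => (T.entry (r, k) : ℕ)) (fun k hk => ?_) (fun k _ l _ h => ?_)
    fun j hj => ?_
  · simpa [word_entry] using hk
  · simpa [entry_inj] using h
  · obtain ⟨hji, hw⟩ := Finset.mem_filter.1 hj
    rw [Finset.mem_range] at hji
    obtain ⟨s, k, rfl⟩ := T.exists_entry_eq (hji.trans_le hi)
    rw [word_entry] at hw
    subst hw
    exact ⟨k, by simpa using hji, rfl⟩

theorem letterCount_entry (r : Fin 3) (k : Fin n) :
    letterCount T.word r (T.entry (r, k)) = k := by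
  have : (Finset.univ.filter fun l => (T.entry (r, l) : ℕ) < T.entry (r, k)) = Finset.Iio k := by
    ext l
    simpa using (T.row_lt r).lt_iff_lt
  rw [letterCount_word (Fin.is_lt _).le, this, Fin.card_Iio]

theorem letterCount_last : letterCount T.word r (3 * n) = n := by
  simp [letterCount_word le_rfl]

theorem letterCount_antitone (hi : i ≤ 3 * n) (hr : r < r') :
    letterCount T.word r' i ≤ letterCount T.word r i := by
  rw [letterCount_word hi, letterCount_word hi]
  refine Finset.card_le_card fun k => ?_
  simp only [Finset.mem_filter, Finset.mem_univ, true_and]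
  exact (Fin.lt_def.1 (T.col_lt k hr)).trans

theorem entry_eq_nth (r : Fin 3) (k : Fin n) :
    (T.entry (r, k) : ℕ) = Nat.nth (fun j => T.word j = r) k := by
  rw [← T.letterCount_entry r k]
  exact (Nat.nth_count (T.word_entry r k)).symm

theorem eq_of_word_eq (h : ∀ i < 3 * n, T.word i = T'.word i) : T = T' := by
  have hword : T.word = T'.word := funext fun i =>
    if hi : i < 3 * n then h i hi else by rw [word, word, dif_neg hi, dif_neg hi]
  have hentry : T.entry = T'.entry := Equiv.ext fun ⟨r, k⟩ =>
    Fin.ext (by rw [entry_eq_nth, entry_eq_nth, hword])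
  cases T
  cases T'
  subst hentry
  rfl

theorem word_schutzenberger (hi : i < 3 * n) :
    T.schutzenberger.word i = (T.word (3 * n - 1 - i)).rev := by
  obtain ⟨r, k, rfl⟩ := T.schutzenberger.exists_entry_eq hi
  have hrev : 3 * n - 1 - (T.schutzenberger.entry (r, k) : ℕ) = T.entry (r.rev, k.rev) := by
    have : T.schutzenberger.entry (r, k) = (T.entry (r.rev, k.rev)).rev := rfl
    rw [this, Fin.val_rev]
    omega
  rw [hrev, word_entry, word_entry, Fin.rev_rev]

end Tableau

theorem lt_card_of_lt_count {p : ℕ → Prop} [DecidablePred p] {k N : ℕ} (h : k < Nat.count p N)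
    (hf : {i | p i}.Finite) : k < hf.toFinset.card := by
  rw [Nat.count_eq_card_filter_range] at h
  exact h.trans_le (Finset.card_le_card fun i hi =>
    hf.mem_toFinset.2 (Finset.mem_filter.1 hi).2)

theorem nth_lt_nth_of_count_le {p q : ℕ → Prop} [DecidablePred p] [DecidablePred q] {k N : ℕ}
    (hpq : ∀ i, p i → ¬ q i) (hle : ∀ i ≤ N, Nat.count q i ≤ Nat.count p i)
    (hk : k < Nat.count q N) : Nat.nth p k < Nat.nth q k := by
  have hq := Nat.nth_mem k (lt_card_of_lt_count hk)
  have hcount := hle (Nat.nth q k + 1) (Nat.nth_lt_of_lt_count hk)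
  rw [Nat.count_nth_succ (lt_card_of_lt_count hk)] at hcount
  have hp := Nat.nth_mem k (lt_card_of_lt_count hcount)
  exact lt_of_le_of_ne (Nat.lt_succ_iff.1 (Nat.nth_lt_of_lt_count hcount))
    fun heq => hpq _ hp (heq ▸ hq)

theorem exists_tableau_of_letterCount {n : ℕ} {w : ℕ → Fin 3}
    (hlast : ∀ r, letterCount w r (3 * n) = n)
    (h01 : ∀ i ≤ 3 * n, letterCount w 1 i ≤ letterCount w 0 i)
    (h12 : ∀ i ≤ 3 * n, letterCount w 2 i ≤ letterCount w 1 i) :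
    ∃ T : Tableau n, ∀ i < 3 * n, T.word i = w i := by
  have hlt (r) (k : Fin n) : (k : ℕ) < letterCount w r (3 * n) := by rw [hlast]; exact k.2
  let entry : Fin 3 × Fin n → Fin (3 * n) := fun x =>
    ⟨Nat.nth (fun j => w j = x.1) x.2, Nat.nth_lt_of_lt_count (hlt x.1 x.2)⟩
  have word_entry (r) (k : Fin n) : w (entry (r, k)) = r :=
    Nat.nth_mem k (lt_card_of_lt_count (hlt r k))
  have row_lt (r) : StrictMono fun k : Fin n => entry (r, k) := fun k l hkl =>
    Nat.nth_lt_nth' hkl (lt_card_of_lt_count (hlt r l))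
  have col_lt (k : Fin n) : StrictMono fun r : Fin 3 => entry (r, k) := by
    rw [Fin.strictMono_iff_lt_succ]
    intro r
    fin_cases r
    · exact nth_lt_nth_of_count_le (fun i h h' => by simp [h] at h') h01 (hlt 1 k)
    · exact nth_lt_nth_of_count_le (fun i h h' => by simp [h] at h') h12 (hlt 2 k)
  have hinj : entry.Injective := by
    rintro ⟨r, k⟩ ⟨s, l⟩ h
    obtain rfl : r = s := by rw [← word_entry r k, ← word_entry s l, h]
    rw [(row_lt r).injective h]
  have hbij : entry.Bijective :=
    (Fintype.bijective_iff_injective_and_card _).2 ⟨hinj, by simp⟩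
  let T : Tableau n := ⟨Equiv.ofBijective entry hbij, row_lt, col_lt⟩
  refine ⟨T, fun i hi => ?_⟩
  obtain ⟨r, k, rfl⟩ := T.exists_entry_eq hi
  rw [T.word_entry]
  exact (word_entry r k).symm

namespace RootedData.IsSweep

variable {K : RootedData} {N n i : ℕ} {w : ℕ → Fin 3} {s : ℕ → Scan K}

theorem length_right_left (h : K.IsSweep N w s) (hi : i ≤ N) :
    (s i).right.length + letterCount w 1 i = letterCount w 0 i ∧
      (s i).left.length + letterCount w 2 i = letterCount w 1 i := by
  induction i with
  | zero => simp [letterCount, h.left_zero, h.right_zero]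
  | succ i ih =>
    obtain ⟨h1, h2⟩ := ih (by omega)
    rcases h.step i hi with
      ⟨hr, -, -, hl, hright⟩ | ⟨-, hr, -, -, hl, hright⟩ | ⟨hr, -, -, hl, hright⟩ <;>
    · simp only [hl, hright, List.length_cons] at h1 h2 ⊢
      simp [letterCount_succ, hr]
      omega

theorem exists_tableau (h : K.IsSweep (3 * n) w s) :
    ∃ T : Tableau n, ∀ i < 3 * n, T.word i = w i := by
  obtain ⟨hright, hleft⟩ := h.length_right_left le_rfl
  have hsum := sum_letterCount w (3 * n)
  rw [h.right_last, List.length_nil] at hright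
  rw [h.left_last, List.length_nil] at hleft
  refine exists_tableau_of_letterCount (fun r => ?_) (fun i hi => ?_) fun i hi => ?_
  · obtain rfl | rfl | rfl := fin_three_cases r <;> omega
  · have := (h.length_right_left hi).1; omega
  · have := (h.length_right_left hi).2; omega

end RootedData.IsSweep

/-! ## Assembling the prograph of a tableau -/

namespace Tableau

variable {n : ℕ} {T : Tableau n} {i : ℕ} {x y : Half n}

/-- The number of entries that are read before an operator is created. -/
def opTime (T : Tableau n) : Fin n ⊕ Fin n → ℕ :=
  Sum.elim (fun k => T.entry (0, k)) fun k => T.entry (2, k)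

theorem opTime_injective : T.opTime.Injective := by
  rintro (k | k) (l | l) <;> simp [opTime, entry_inj]

theorem opTime_lt (v : Fin n ⊕ Fin n) : T.opTime v < 3 * n := by
  cases v <;> exact Fin.is_lt _

theorem opTime_ne_entry_one (v : Fin n ⊕ Fin n) (k : Fin n) : T.opTime v ≠ T.entry (1, k) := by
  cases v <;> simp [opTime, entry_inj]

/-- The operators that are not yet created after `i` entries. -/
def later (T : Tableau n) (i : ℕ) : Set (Fin n ⊕ Fin n) := {v | i ≤ T.opTime v}

theorem mem_later_opTime (v : Fin n ⊕ Fin n) : v ∈ T.later (T.opTime v) :=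
  le_refl (T.opTime v)

theorem later_opTime_succ (v : Fin n ⊕ Fin n) :
    T.later (T.opTime v + 1) = T.later (T.opTime v) \ {v} := by
  ext u
  simp only [later, Set.mem_ofPred_eq, Set.mem_sdiff, Set.mem_singleton_iff,
    ← T.opTime_injective.eq_iff (a := u)]
  omega

theorem later_entry_one_succ (k : Fin n) :
    T.later (T.entry (1, k) + 1) = T.later (T.entry (1, k)) := by
  ext u
  have := T.opTime_ne_entry_one u k
  simp only [later, Set.mem_ofPred_eq]
  omega

theorem later_last : T.later (3 * n) = ∅ :=
  Set.eq_empty_of_forall_notMem fun v => (T.opTime_lt v).not_ge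

variable [NeZero n]

theorem entry_zero : (T.entry (0, 0) : ℕ) = 0 := by
  obtain ⟨r, k, h⟩ := T.exists_entry_eq (i := 0) (by have := NeZero.pos n; omega)
  have hrow : T.entry (0, 0) ≤ T.entry (0, k) := (T.row_lt 0).monotone (Fin.zero_le k)
  have hcol : T.entry (0, k) ≤ T.entry (r, k) := (T.col_lt k).monotone (Fin.zero_le r)
  have := Fin.le_def.1 (hrow.trans hcol)
  omega

theorem entry_last : (T.entry (2, Fin.rev 0) : ℕ) + 1 = 3 * n := by
  obtain ⟨r, k, h⟩ := T.exists_entry_eq (i := 3 * n - 1) (by have := NeZero.pos n; omega)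
  have hk : k ≤ Fin.rev 0 := Fin.le_rev_iff.2 (Fin.zero_le _)
  have hrow : T.entry (2, k) ≤ T.entry (2, Fin.rev 0) := (T.row_lt 2).monotone hk
  have hcol : T.entry (r, k) ≤ T.entry (2, k) := (T.col_lt k).monotone (Fin.le_last r)
  have := Fin.le_def.1 (hcol.trans hrow)
  have := (T.entry (2, Fin.rev 0)).2
  omega

theorem later_one : T.later 1 = {v | v ≠ .inl 0} := by
  ext v
  have hzero : T.opTime (.inl 0) = 0 := T.entry_zero
  simp only [later, Set.mem_ofPred_eq, ne_eq, ← T.opTime_injective.eq_iff (a := v), hzero]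
  omega

/-- The state of the assembling after `i` entries. -/
def assembly (T : Tableau n) (i : ℕ) : Assembly n :=
  ((List.finRange (3 * n)).take i).foldl (Assembly.step T) ⟨[copIn 0], [], 1⟩

theorem assembly_zero : T.assembly 0 = ⟨[copIn 0], [], 1⟩ := rfl

theorem assembly_succ (hi : i < 3 * n) :
    T.assembly (i + 1) = Assembly.step T (T.assembly i) ⟨i, hi⟩ := by
  have hlen : i < (List.finRange (3 * n)).length := by simpa
  rw [assembly, List.take_succ_eq_append_getElem hlen, List.foldl_append]
  simp [assembly]

theorem prograph_eq : T.prograph = glued (T.assembly (3 * n)).glue := by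
  rw [assembly, List.take_of_length_le (by simp)]
  rfl

omit [NeZero n] in
/-- A step of the assembling in which all the wires needed are available. -/
inductive Next (T : Tableau n) (i : ℕ) (A B : Assembly n) : Prop
  | coproduct (k : Fin n) (o : Half n) (P : List (Half n)) (entry : (T.entry (0, k) : ℕ) = i)
      (pending : A.pending = o :: P)
      (eq : B = ⟨copLeft k :: copRight k :: P, A.waiting, A.glue * swap o (copIn k)⟩)
  | wait (k : Fin n) (o : Half n) (P : List (Half n)) (entry : (T.entry (1, k) : ℕ) = i)
      (pending : A.pending = o :: P) (eq : B = ⟨P, o :: A.waiting, A.glue⟩)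
  | product (k : Fin n) (o y : Half n) (P W : List (Half n)) (entry : (T.entry (2, k) : ℕ) = i)
      (pending : A.pending = o :: P) (waiting : A.waiting = y :: W)
      (eq : B = ⟨prodOut k :: P, W, A.glue * swap y (prodLeft k) * swap o (prodRight k)⟩)

theorem next_of_length (hi : i < 3 * n)
    (hpending : (T.assembly i).pending.length + letterCount T.word 1 i =
      letterCount T.word 0 i + 1)
    (hwaiting : (T.assembly i).waiting.length + letterCount T.word 2 i =
      letterCount T.word 1 i) : T.Next i (T.assembly i) (T.assembly (i + 1)) := by
  have h01 := T.letterCount_antitone hi.le (show (0 : Fin 3) < 1 by decide)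
  have h12 := T.letterCount_antitone (Nat.succ_le_of_lt hi) (show (1 : Fin 3) < 2 by decide)
  rw [assembly_succ hi]
  obtain ⟨r, k, rfl⟩ := T.exists_entry_eq hi
  simp only [Nat.succ_eq_add_one, letterCount_succ, word_entry] at h12
  generalize T.assembly (T.entry (r, k)) = A at hpending hwaiting ⊢
  obtain ⟨pending, waiting, g⟩ := A
  obtain ⟨o, P, rfl⟩ := List.exists_cons_of_length_pos (l := pending) (by simp at *; omega)
  obtain rfl | rfl | rfl := fin_three_cases r
  · exact .coproduct k o P rfl rfl (by simp [Assembly.step])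
  · exact .wait k o P rfl rfl (by simp [Assembly.step])
  · obtain ⟨y, W, rfl⟩ := List.exists_cons_of_length_pos (l := waiting) (by simp at *; omega)
    exact .product k o y P W rfl rfl rfl (by simp [Assembly.step])

theorem length_assembly (hi : i ≤ 3 * n) :
    (T.assembly i).pending.length + letterCount T.word 1 i = letterCount T.word 0 i + 1 ∧
      (T.assembly i).waiting.length + letterCount T.word 2 i = letterCount T.word 1 i := by
  induction i with
  | zero => simp [assembly_zero, letterCount]
  | succ i ih =>
    obtain ⟨hpending, hwaiting⟩ := ih (by omega)
    rcases next_of_length hi hpending hwaiting with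
      ⟨k, o, P, rfl, hP, hA⟩ | ⟨k, o, P, rfl, hP, hA⟩ | ⟨k, o, y, P, W, rfl, hP, hW, hA⟩
    · simp only [hA, hP, letterCount_succ, word_entry, List.length_cons] at hpending ⊢
      simp
      omega
    · simp only [hA, hP, letterCount_succ, word_entry, List.length_cons] at hpending ⊢
      simp
      omega
    · simp only [hA, hP, hW, letterCount_succ, word_entry, List.length_cons] at hpending hwaiting ⊢
      simp
      omega

theorem next_assembly (hi : i < 3 * n) : T.Next i (T.assembly i) (T.assembly (i + 1)) :=
  next_of_length hi (length_assembly hi.le).1 (length_assembly hi.le).2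

theorem exists_assembly_coproduct (k : Fin n) :
    ∃ o P, (T.assembly (T.entry (0, k))).pending = o :: P ∧
      T.assembly (T.entry (0, k) + 1) = ⟨copLeft k :: copRight k :: P,
        (T.assembly (T.entry (0, k))).waiting,
        (T.assembly (T.entry (0, k))).glue * swap o (copIn k)⟩ := by
  rcases T.next_assembly (T.entry (0, k)).2 with
    ⟨l, o, P, hl, hP, hA⟩ | ⟨l, -, -, hl, -⟩ | ⟨l, -, -, -, -, hl, -⟩
  · obtain rfl : l = k := by simpa [entry_inj] using hl
    exact ⟨o, P, hP, hA⟩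
  all_goals simp [entry_inj] at hl

theorem exists_pending_product (k : Fin n) :
    ∃ P, (T.assembly (T.entry (2, k) + 1)).pending = prodOut k :: P := by
  rcases T.next_assembly (T.entry (2, k)).2 with
    ⟨l, -, -, hl, -⟩ | ⟨l, -, -, hl, -⟩ | ⟨l, o, y, P, W, hl, hP, hW, hA⟩
  · simp [entry_inj] at hl
  · simp [entry_inj] at hl
  · obtain rfl : l = k := by simpa [entry_inj] using hl
    exact ⟨P, by rw [hA]⟩

theorem assembly_one : T.assembly 1 = ⟨[copLeft 0, copRight 0], [], 1⟩ := by
  obtain ⟨o, P, hP, hA⟩ := T.exists_assembly_coproduct 0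
  rw [entry_zero, assembly_zero] at hP hA
  obtain ⟨rfl, rfl⟩ := List.cons.inj hP
  rw [hA, swap_self]
  rfl

theorem pending_last : (T.assembly (3 * n)).pending = [prodOut (Fin.rev 0)] := by
  obtain ⟨P, hP⟩ := T.exists_pending_product (Fin.rev 0)
  rw [entry_last] at hP
  have hlen := (T.length_assembly le_rfl).1
  rw [hP, letterCount_last, letterCount_last, List.length_cons] at hlen
  rw [hP, List.eq_nil_of_length_eq_zero (l := P) (by omega)]

theorem waiting_last : (T.assembly (3 * n)).waiting = [] := by
  have hlen := (T.length_assembly le_rfl).2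
  rw [letterCount_last, letterCount_last] at hlen
  exact List.eq_nil_of_length_eq_zero (by omega)

theorem isGluing_assembly (hpos : 0 < i) (hi : i ≤ 3 * n) :
    IsGluing (T.later i) ((T.assembly i).pending ++ (T.assembly i).waiting)
      (T.assembly i).glue := by
  induction i, hpos using Nat.le_induction with
  | base =>
    rw [Nat.succ_eq_add_one, Nat.zero_add, assembly_one, later_one]
    exact .initial
  | succ i hpos ih =>
    specialize ih (by omega)
    rcases T.next_assembly hi with
      ⟨k, o, P, hk, hP, hA⟩ | ⟨k, o, P, rfl, hP, hA⟩ | ⟨k, o, y, P, W, hk, hP, hW, hA⟩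
    · obtain rfl : T.opTime (.inl k) = i := hk
      rw [hP] at ih
      rw [hA, later_opTime_succ]
      exact ih.coproduct (mem_later_opTime _)
    · rw [hP] at ih
      rw [hA, later_entry_one_succ]
      exact ih.of_perm List.perm_middle.symm
    · obtain rfl : T.opTime (.inr k) = i := hk
      rw [hP, hW] at ih
      rw [hA, later_opTime_succ]
      exact (ih.of_perm (List.perm_middle.cons o)).product (mem_later_opTime _)

end Tableau

theorem RootedData.IsSweep.isReading {K : RootedData} {N : ℕ} {w : ℕ → Fin 3} {s : ℕ → Scan K}
    (h : K.IsSweep N w s) (hK : K.IsCubic) (hN : Nat.card K.D = 2 * N)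
    (hsurj : ∀ d, K.out d = true → ∃ i < N, (s i).cur = d) : K.IsReading N w s := by
  let halfEdge (x : Fin N × Bool) : K.D := if x.2 then (s x.1).cur else K.α (s x.1).cur
  have halfEdge_surjective : halfEdge.Surjective := fun d => by
    cases hd : K.out d
    · obtain ⟨i, hi, hcur⟩ := hsurj (K.α d) (by rw [hK.out_α, hd]; rfl)
      exact ⟨(⟨i, hi⟩, false), by simp [halfEdge, hcur, hK.α_α]⟩
    · obtain ⟨i, hi, hcur⟩ := hsurj d hd
      exact ⟨(⟨i, hi⟩, true), by simp [halfEdge, hcur]⟩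
  have halfEdge_bijective : halfEdge.Bijective :=
    halfEdge_surjective.bijective_of_nat_card_le (by rw [hN]; simp [mul_comm])
  refine ⟨h, hsurj, fun i hi j hj hij => ?_⟩
  have := halfEdge_bijective.1 (a₁ := (⟨i, hi⟩, true)) (a₂ := (⟨j, hj⟩, true))
    (by simp [halfEdge, hij])
  simpa using this

namespace Tableau

variable {n : ℕ} [NeZero n] {T : Tableau n} {i j : ℕ} {x y : Half n}

theorem glue_succ_apply (hpos : 0 < i) (hi : i < 3 * n) (hx : (T.assembly i).glue x ≠ x) :
    (T.assembly (i + 1)).glue x = (T.assembly i).glue x := by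
  have h := T.isGluing_assembly hpos hi.le
  have ne_wire {a} (ha : a ∈ (T.assembly i).pending ++ (T.assembly i).waiting) : x ≠ a := by
    rintro rfl
    exact hx (h.apply_of_mem ha)
  have ne_new {a : Half n} (ha : T.opTime a.1 = i) : x ≠ a := by
    rintro rfl
    exact hx (h.apply_of_fst_mem ha.ge)
  rcases T.next_assembly hi with
    ⟨k, o, P, hk, hP, hA⟩ | ⟨_, _, _, _, _, hA⟩ | ⟨k, o, y, P, W, hk, hP, hW, hA⟩
  · have hxo : x ≠ o := ne_wire (by simp [hP])
    rw [hA, mul_swap_apply_of_ne hxo (ne_new (a := copIn k) hk)]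
  · rw [hA]
  · have hxo : x ≠ o := ne_wire (by simp [hP])
    have hxy : x ≠ y := ne_wire (by simp [hW])
    rw [hA, mul_swap_apply_of_ne hxo (ne_new (a := prodRight k) hk),
      mul_swap_apply_of_ne hxy (ne_new (a := prodLeft k) hk)]

theorem glue_apply_of_le (hpos : 0 < i) (hij : i ≤ j) (hj : j ≤ 3 * n)
    (hx : (T.assembly i).glue x ≠ x) : (T.assembly j).glue x = (T.assembly i).glue x := by
  induction j, hij using Nat.le_induction with
  | base => rfl
  | succ j hij ih =>
    specialize ih (by omega)
    rw [glue_succ_apply (by omega) hj (ih.trans_ne hx), ih]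

/-- The prograph of a tableau, written as a gluing. -/
abbrev gluedPrograph (T : Tableau n) : PrographData := glued (T.assembly (3 * n)).glue

theorem isGluing_last : IsGluing ∅ [prodOut (Fin.rev 0)] (T.assembly (3 * n)).glue := by
  simpa only [later_last, pending_last, waiting_last, List.append_nil] using
    T.isGluing_assembly (NeZero.pos (3 * n)) le_rfl

theorem glue_last_apply_eq_self_iff :
    (T.assembly (3 * n)).glue x = x ↔ x = prodOut (Fin.rev 0) ∨ x = copIn 0 := by
  simp [isGluing_last.apply_eq_self_iff]

theorem hasLegs : T.gluedPrograph.HasLegs :=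
  ⟨glue_last_apply_eq_self_iff.2 (.inr rfl), glue_last_apply_eq_self_iff.2 (.inl rfl)⟩

theorem isCubic : T.gluedPrograph.closed.IsCubic := by
  have hmatching := isGluing_last.toIsMatching.mul_swap (T.hasLegs).inLeg hasLegs.outLeg rfl
  refine ⟨hmatching.apply_apply, fun d => hmatching.out_apply d fun hfix => ?_,
    exists_operator_glued, isProduct_glued _, ?_⟩
  · obtain ⟨hd, hin, hout⟩ :=
      (IsMatching.mul_swap_apply_eq_self_iff hasLegs.inLeg hasLegs.outLeg rfl).1 hfix
    exact (glue_last_apply_eq_self_iff.1 hd).elim hout hin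
  · rw [hasLegs.closed_α_outLeg]
    exact isCoproduct_glued 0

theorem closed_α_apply (hpos : 0 < i) (hi : i ≤ 3 * n) (h : (T.assembly i).glue x = y)
    (hx : x.out = true) (hy : y.out = false) : T.gluedPrograph.closed.α x = y := by
  have hne : (T.assembly i).glue x ≠ x := by
    rw [h]
    rintro rfl
    simp [hx] at hy
  have hlast := T.glue_apply_of_le hpos hi le_rfl hne
  have hlegs : ¬(x = prodOut (Fin.rev 0) ∨ x = copIn 0) := by
    rw [← T.glue_last_apply_eq_self_iff, hlast]
    exact hne
  rw [not_or] at hlegs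
  exact (PrographData.closed_α_of_ne hlegs.2 hlegs.1).trans (hlast.trans h)

theorem isStack_waiting : IsStack (3 * n) fun i => (T.assembly i).waiting := fun _ hi =>
  match T.next_assembly hi with
  | .coproduct _ _ _ _ _ eq => .inl (congrArg Assembly.waiting eq :)
  | .wait _ _ _ _ _ eq => .inr (.inl ⟨_, congrArg Assembly.waiting eq⟩)
  | .product _ _ _ _ _ _ _ hW eq =>
    .inr (.inr ⟨_, hW.trans (congrArg (_ :: ·) (congrArg Assembly.waiting eq).symm)⟩)

theorem exists_closed_α_waiting (hpos : 0 < i) (hi : i ≤ 3 * n) {W : List (Half n)}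
    (hx : (T.assembly i).waiting = x :: W) :
    ∃ k, T.gluedPrograph.closed.α x = prodLeft k := by
  obtain ⟨j, hij, hj, hpop, hsucc⟩ :=
    T.isStack_waiting.exists_pop waiting_last hi (by rw [hx])
  have h := T.isGluing_assembly (hpos.trans_le hij) hj.le
  rcases T.next_assembly hj with
    ⟨_, _, _, _, _, hA⟩ | ⟨_, _, _, _, _, hA⟩ | ⟨k, o, y, P, W, hk, hP, hW, hA⟩
  · simp [hA, hpop] at hsucc
  · exact absurd (congrArg List.length hsucc) (by simp [hA, hpop]; omega)
  · obtain ⟨rfl, rfl⟩ := List.cons.inj (hpop.symm.trans hW)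
    rw [hP, hW] at h
    have hperm := h.of_perm (List.perm_middle.cons o)
    refine ⟨k, closed_α_apply (Nat.succ_pos j) hj ?_ (hperm.out_of_mem x (by simp)) rfl⟩
    rw [hA]
    exact hperm.product_apply_left hk.ge

/-- The cut of the prograph before the entry `i + 1` is read. -/
def scan (T : Tableau n) (i : ℕ) : RootedData.Scan T.gluedPrograph.closed :=
  if i = 0 then ⟨prodOut (Fin.rev 0), [], []⟩ else
    ⟨(T.assembly i).pending.headD (copIn 0), (T.assembly i).waiting, (T.assembly i).pending.tail⟩

theorem scan_eq (hpos : 0 < i) {P : List (Half n)} (hP : (T.assembly i).pending = x :: P) :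
    T.scan i = ⟨x, (T.assembly i).waiting, P⟩ := by
  rw [scan, if_neg hpos.ne', hP]
  rfl

theorem scan_last : T.scan (3 * n) = ⟨prodOut (Fin.rev 0), [], []⟩ := by
  rw [scan_eq (NeZero.pos (3 * n)) pending_last, waiting_last]
  rfl

theorem step_scan_coproduct {s t : RootedData.Scan T.gluedPrograph.closed} {k : Fin n}
    (hα : T.gluedPrograph.closed.α s.cur = copIn k) (cur : t.cur = copLeft k)
    (left : t.left = s.left) (right : t.right = copRight k :: s.right) :
    T.gluedPrograph.closed.Step 0 s t := by
  refine .coproduct rfl ?_ ?_ left ?_ <;> rw [hα]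
  · exact isCoproduct_glued k
  · exact cur
  · exact right

theorem step_scan_zero : T.gluedPrograph.closed.Step (T.word 0) (T.scan 0) (T.scan 1) := by
  have hword : T.word 0 = 0 := by rw [← T.word_entry 0 0, entry_zero]
  have hscan := T.scan_eq one_pos (congrArg Assembly.pending assembly_one)
  rw [assembly_one] at hscan
  rw [hword, hscan]
  exact step_scan_coproduct hasLegs.closed_α_outLeg rfl rfl rfl

theorem step_scan_of_pos (hpos : 0 < i) (hi : i < 3 * n) :
    T.gluedPrograph.closed.Step (T.word i) (T.scan i) (T.scan (i + 1)) := by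
  have h := T.isGluing_assembly hpos hi.le
  rcases T.next_assembly hi with
    ⟨k, o, P, hk, hP, hA⟩ | ⟨k, o, P, rfl, hP, hA⟩ | ⟨k, o, y, P, W, hk, hP, hW, hA⟩
  · rw [hP] at h
    have hα : T.gluedPrograph.closed.α o = copIn k := by
      refine closed_α_apply (Nat.succ_pos i) hi ?_ (h.out_of_mem o (by simp)) rfl
      rw [hA]
      exact h.coproduct_apply hk.ge
    rw [← hk, word_entry, hk, scan_eq hpos hP,
      scan_eq (Nat.succ_pos i) (congrArg Assembly.pending hA), hA]
    exact step_scan_coproduct hα rfl rfl rfl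
  · obtain ⟨l, hl⟩ := T.exists_closed_α_waiting (Nat.succ_pos _) hi (congrArg Assembly.waiting hA)
    obtain ⟨o', P', rfl⟩ : ∃ o' P', P = o' :: P' := by
      have hlen := (T.length_assembly (i := T.entry (1, k) + 1) hi).1
      have hcount := T.letterCount_antitone (i := T.entry (1, k) + 1) hi
        (show (0 : Fin 3) < 1 by decide)
      simp only [hA] at hlen
      exact List.exists_cons_of_length_pos (by omega)
    rw [word_entry, scan_eq hpos hP, scan_eq (Nat.succ_pos _) (congrArg Assembly.pending hA), hA]
    exact .leftInput (prodOut l) rfl (isProduct_glued l) hl rfl rfl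
  · rw [hP, hW] at h
    have hperm := h.of_perm (List.perm_middle.cons o)
    have hα : T.gluedPrograph.closed.α o = prodRight k := by
      refine closed_α_apply (Nat.succ_pos i) hi ?_ (h.out_of_mem o (by simp)) rfl
      rw [hA]
      exact hperm.product_apply_right hk.ge
    have hαy : T.gluedPrograph.closed.α (prodLeft k) = y := by
      refine (isCubic.α_eq_iff).2 (closed_α_apply (Nat.succ_pos i) hi ?_
        (h.out_of_mem y (by simp)) rfl).symm
      rw [hA]
      exact hperm.product_apply_left hk.ge
    rw [← hk, word_entry, hk, scan_eq hpos hP,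
      scan_eq (Nat.succ_pos i) (congrArg Assembly.pending hA), hA]
    exact .product rfl (isProduct_glued k) hα (hW.trans (congrArg (· :: W) hαy.symm)) rfl

theorem isSweep : T.gluedPrograph.closed.IsSweep (3 * n) T.word T.scan where
  start := rfl
  finish := scan_last
  step i hi := by
    rcases Nat.eq_zero_or_pos i with rfl | hpos
    · exact step_scan_zero
    · exact step_scan_of_pos hpos hi

theorem exists_cur_scan (d : Half n) (hd : d.out = true) :
    ∃ i ≤ 3 * n, (T.scan i).cur = d := by
  obtain ⟨k, rfl | rfl | rfl⟩ := Half.exists_of_out hd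
  · obtain ⟨o, P, -, hA⟩ := T.exists_assembly_coproduct k
    exact ⟨_, (T.entry (0, k)).2, by
      rw [scan_eq (Nat.succ_pos _) (congrArg Assembly.pending hA)]⟩
  · obtain ⟨o, P, -, hA⟩ := T.exists_assembly_coproduct k
    have hright : copRight k :: P <:+ (T.scan (T.entry (0, k) + 1)).right := by
      rw [scan_eq (Nat.succ_pos _) (congrArg Assembly.pending hA)]
    obtain ⟨j, -, hj, hcur, -⟩ := isSweep.exists_pop_right (T.entry (0, k)).2 hright
    exact ⟨j + 1, hj, hcur⟩
  · obtain ⟨P, hP⟩ := T.exists_pending_product k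
    exact ⟨_, (T.entry (2, k)).2, by rw [scan_eq (Nat.succ_pos _) hP]⟩

theorem isReading : T.gluedPrograph.closed.IsReading (3 * n) T.word T.scan := by
  refine isSweep.isReading isCubic ?_ fun d hd => ?_
  · have : Nat.card T.gluedPrograph.closed.D = 6 * n := card_glued (g := (T.assembly (3 * n)).glue)
    omega
  · obtain ⟨i, hi, hcur⟩ := T.exists_cur_scan d hd
    rcases hi.lt_or_eq with hlt | rfl
    · exact ⟨i, hlt, hcur⟩
    · exact ⟨0, NeZero.pos (3 * n), by rw [← hcur, scan_last]; rfl⟩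

theorem isPCPrograph : T.prograph.IsPCPrograph n := by
  rw [prograph_eq]
  exact PrographData.isPCPrograph_of_reading hasLegs isCubic isReading card_glued

end Tableau

/-! ## Isomorphisms, closure and duality -/

namespace RootedData

/-- The map whose dual is `R`. The dual of the dual is the map with its edges reversed, so `dual`
is not an involution and its inverse needs a name of its own. -/
abbrev codual (R : RootedData) : RootedData where
  D := R.D
  σ := R.α * R.σ⁻¹
  α := R.α
  out := R.out
  root := R.root

/-- The prograph obtained by cutting the root edge, the inverse of `PrographData.closed`. -/
abbrev cut (K : RootedData) : PrographData where
  D := K.D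
  σ := K.σ
  α := K.α * swap (K.α K.root) K.root
  out := K.out
  inLeg := K.α K.root
  outLeg := K.root

variable {K K' R : RootedData} {n N : ℕ}

theorem codual_φ : R.codual.φ = R.σ := by
  simp [OMap.φ]

theorem dual_codual : R.codual.dual = R :=
  congrArg (fun σ => { R with σ := σ }) codual_φ

theorem codual_dual : K.dual.codual = K := by
  have hσ : K.α * K.φ⁻¹ = K.σ := by simp [OMap.φ]
  exact congrArg (fun σ => { K with σ := σ }) hσ

theorem closed_cut : K.cut.closed = K := by
  have hα : K.α * swap (K.α K.root) K.root * swap (K.α K.root) K.root = K.α := by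
    rw [mul_assoc, swap_mul_self, mul_one]
  exact congrArg (fun α => { K with α := α }) hα

theorem Iso.dual (h : K.Iso K') : K.dual.Iso K'.dual := by
  obtain ⟨f, hσ, hα, hout, hroot⟩ := h
  refine ⟨f, fun (d : K.D) => ?_, hα, hout, hroot⟩
  change f (K.σ⁻¹ (K.α d)) = K'.σ⁻¹ (K'.α (f d))
  rw [Perm.eq_inv_iff_eq, ← hσ, ← hα]
  exact congrArg f (K.σ.apply_symm_apply _)

theorem Iso.codual (h : K.Iso K') : K.codual.Iso K'.codual := by
  obtain ⟨f, hσ, hα, hout, hroot⟩ := h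
  refine ⟨f, fun (d : K.D) => ?_, hα, hout, hroot⟩
  change f (K.α (K.σ⁻¹ d)) = K'.α (K'.σ⁻¹ (f d))
  rw [hα]
  congr 1
  rw [Perm.eq_inv_iff_eq, ← hσ]
  exact congrArg f (K.σ.apply_symm_apply d)

theorem Iso.of_dual (h : K.dual.Iso K'.dual) : K.Iso K' := by
  simpa only [codual_dual] using h.codual

theorem Iso.cut (h : K.Iso K') : K.cut.Iso K'.cut := by
  obtain ⟨f, hσ, hα, hout, hroot⟩ := h
  have hin : f (K.α K.root) = K'.α K'.root := by rw [hα, hroot]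
  refine ⟨f, hσ, fun d => ?_, hout, hin, hroot⟩
  change f (K.α (swap (K.α K.root) K.root d)) = K'.α (swap (K'.α K'.root) K'.root (f d))
  rw [hα, ← hin, ← hroot, f.injective.swap_apply]

end RootedData

namespace PrographData

variable {M M' : PrographData}

theorem HasLegs.cut_closed (hM : M.HasLegs) : M.closed.cut = M := by
  have hα : M.α * swap M.inLeg M.outLeg * swap M.inLeg M.outLeg = M.α := by
    rw [mul_assoc, swap_mul_self, mul_one]
  unfold RootedData.cut
  rw [hM.closed_α_outLeg]
  exact congrArg (fun α => { M with α := α }) hα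

theorem Iso.closed (h : M.Iso M') : M.closed.Iso M'.closed := by
  obtain ⟨f, hσ, hα, hout, hin, hroot⟩ := h
  refine ⟨f, hσ, fun (d : M.D) => ?_, hout, hroot⟩
  change f (M.α (swap M.inLeg M.outLeg d)) = M'.α (swap M'.inLeg M'.outLeg (f d))
  rw [hα, ← hin, ← hroot, f.injective.swap_apply]

theorem Iso.of_closed (hM : M.HasLegs) (hM' : M'.HasLegs) (h : M.closed.Iso M'.closed) :
    M.Iso M' := by
  simpa only [hM.cut_closed, hM'.cut_closed] using h.cut

end PrographData

namespace RootedData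

variable {K R : RootedData} {n N : ℕ}

theorem IsCubic.hasLegs_cut (hK : K.IsCubic) : K.cut.HasLegs where
  inLeg := congrArg K.α (swap_apply_left _ _)
  outLeg := (congrArg K.α (swap_apply_right _ _)).trans (hK.α_α _)

theorem IsReading.isPCPrograph_cut {w : ℕ → Fin 3} {s : ℕ → Scan K} (h : K.IsReading N w s)
    (hK : K.IsCubic) (hn : Nat.card K.D = 6 * n) : K.cut.IsPCPrograph n := by
  obtain ⟨t, ht⟩ : ∃ t, K.cut.closed.IsReading N w t := by
    rw [closed_cut]
    exact ⟨s, h⟩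
  exact PrographData.isPCPrograph_of_reading hK.hasLegs_cut (closed_cut.symm ▸ hK) ht hn

namespace IsBipolarTriangulation

variable (hR : R.IsBipolarTriangulation n)
include hR

theorem α_α (d : R.D) : R.α (R.α d) = d := hR.wellFormed.1 d

theorem out_α (d : R.D) : R.out (R.α d) = !R.out d := hR.wellFormed.2 d (hR.no_dangling d)

theorem out_of_sameCycle_root {d : R.D} (hd : R.σ.SameCycle R.root d) : R.out d = true :=
  (hR.source R.root).2 (.refl _ _) d hd

theorem out_of_sameCycle_α_root {d : R.D} (hd : R.σ.SameCycle (R.α R.root) d) :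
    R.out d = false :=
  (hR.sink (R.α R.root)).2 (.refl _ _) d hd

theorem codual_σ_apply (d : R.D) : R.codual.σ d = R.α (R.φ (R.α d)) :=
  congrArg (fun x => R.α (R.σ⁻¹ x)) (hR.α_α d).symm

theorem codual_σ_σ_σ (d : R.D) : R.codual.σ (R.codual.σ (R.codual.σ d)) = d := by
  simp only [hR.codual_σ_apply, hR.α_α, (hR.triangles _).2]

theorem codual_σ_ne (d : R.D) : R.codual.σ d ≠ d := fun h => by
  rw [hR.codual_σ_apply] at h
  exact (hR.triangles (R.α d)).1 ((hR.α_α _).symm.trans (congrArg R.α h))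

theorem sameCycle_α_codual_σ (d : R.D) : R.σ.SameCycle d (R.α (R.codual.σ d)) :=
  (hR.α_α (R.σ⁻¹ d)).symm ▸ (sameCycle_self_apply R.σ⁻¹ d).of_inv

theorem sameCycle_codual_σ_σ_α (d : R.D) :
    R.σ.SameCycle (R.codual.σ (R.codual.σ d)) (R.α d) := by
  simpa only [hR.codual_σ_σ_σ] using hR.sameCycle_α_codual_σ (R.codual.σ (R.codual.σ d))

theorem exists_codual_out_eq (d : R.D) (b : Bool) :
    ∃ e, R.codual.σ.SameCycle d e ∧ R.out e = b := by
  by_contra! h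
  cases b
  · refine hR.acyclic d (Relation.transGen_swap.1 ?_)
    refine transGen_self_of_forall_sameCycle (f := R.codual.σ) fun e he => ?_
    exact ⟨_, Bool.eq_true_of_not_eq_false (h _ (Perm.sameCycle_apply_right.2 he)),
      hR.no_dangling _, .refl _ _, (hR.sameCycle_α_codual_σ e).symm⟩
  · refine hR.acyclic d
      (transGen_self_of_forall_sameCycle (f := R.codual.σ) fun e he => ?_)
    refine ⟨R.α (R.codual.σ e), ?_, hR.no_dangling _, hR.sameCycle_α_codual_σ e, ?_⟩
    · rw [hR.out_α, Bool.eq_false_of_not_eq_true (h _ (Perm.sameCycle_apply_right.2 he))]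
      rfl
    · rw [hR.α_α]

theorem exists_codual_operator (d : R.D) : ∃ e, R.codual.σ.SameCycle d e ∧
    (R.codual.IsCoproduct e ∨ R.codual.IsProduct e) := by
  obtain ⟨x, hdx, hx⟩ := hR.exists_codual_out_eq d false
  obtain ⟨y, hdy, hy⟩ := hR.exists_codual_out_eq d true
  obtain ⟨e, hxe, he, he'⟩ := exists_sameCycle_transition (f := R.codual.σ) R.out
    (hdx.symm.trans hdy) (by simp [hx, hy])
  rw [hx] at he he'
  have hde := hdx.trans hxe
  have he' : R.out (R.codual.σ e) = true := Bool.eq_true_of_not_eq_false he'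
  have h3 := hR.codual_σ_σ_σ e
  cases he'' : R.out (R.codual.σ (R.codual.σ e))
  · refine ⟨R.codual.σ e, Perm.sameCycle_apply_right.2 hde, .inr ?_⟩
    exact ⟨hR.codual_σ_σ_σ _, he', he'', (congrArg R.out h3).trans he, hR.codual_σ_ne _⟩
  · exact ⟨e, hde, .inl ⟨h3, he, he', he'', hR.codual_σ_ne _⟩⟩

theorem isCubic_codual : R.codual.IsCubic where
  α_α := hR.α_α
  out_α := hR.out_α
  operators := hR.exists_codual_operator
  root_product := by
    have hleft := hR.out_of_sameCycle_root (hR.sameCycle_α_codual_σ R.root)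
    rw [hR.out_α, Bool.not_eq_true'] at hleft
    exact ⟨hR.codual_σ_σ_σ _, hR.out_of_sameCycle_root (.refl _ _), hleft,
      hR.out_of_sameCycle_α_root (hR.sameCycle_codual_σ_σ_α R.root).symm, hR.codual_σ_ne _⟩
  root_coproduct := by
    have hright := hR.out_of_sameCycle_α_root (hR.sameCycle_α_codual_σ (R.α R.root))
    rw [hR.out_α, Bool.not_eq_false'] at hright
    have hleft := hR.sameCycle_codual_σ_σ_α (R.α R.root)
    rw [hR.α_α] at hleft
    exact ⟨hR.codual_σ_σ_σ _, hR.out_of_sameCycle_α_root (.refl _ _), hright,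
      hR.out_of_sameCycle_root hleft.symm, hR.codual_σ_ne _⟩

theorem bothDirections_codual : R.codual.BothDirections := by
  intro d hroot hroot'
  rw [codual_φ] at *
  have hsource : ¬ R.IsSource d := fun h => hroot ((hR.source d).1 h).symm
  have hsink : ¬ R.IsSink d := fun h => hroot' ((hR.sink d).1 h).symm
  simp only [OMap.IsSource, OMap.IsSink, not_forall, exists_prop, Bool.not_eq_true,
    Bool.not_eq_false] at hsource hsink
  exact ⟨hsink, hsource⟩

theorem connected_codual : R.codual.Connected := fun x y => by
  have linked_α (x : R.D) : R.codual.Linked x (R.α x) := OMap.linked_α (K := R.codual.toOMap) x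
  have linked_σ_α (x : R.D) : R.codual.Linked (R.σ x) (R.α x) :=
    .rel _ _ (.inl (congrArg R.α (R.σ.symm_apply_apply x).symm))
  refine Setoid.eqvGen_le (s := Relation.EqvGen.setoid _) (fun x y hxy => ?_) (hR.connected x y)
  rcases hxy with rfl | rfl
  · exact (linked_α x).trans _ _ _ (linked_σ_α x).symm
  · exact linked_α x

theorem card_eq : Nat.card R.D = 6 * n := by
  have h : Nat.card R.D = 3 * R.numFaces := card_eq_prime_mul_card_cycles Nat.prime_three
    (Perm.ext fun d => (hR.triangles d).2) fun d => (hR.triangles d).1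
  have := hR.size
  omega

theorem isPCPrograph_cut_codual : R.codual.cut.IsPCPrograph n := by
  have hK := hR.isCubic_codual
  have hcard := hR.card_eq
  have hE : Nat.card R.D = 2 * R.numEdges := hK.card_eq_two_mul_numEdges
  have hV : Nat.card R.D = 3 * R.codual.numVertices := hK.card_eq_three_mul_numVertices
  have hF : R.codual.numFaces = R.numVertices :=
    congrArg (fun f : Perm R.D => Nat.card (Quotient (Perm.SameCycle.setoid f))) codual_φ
  have hsphere : R.numVertices + R.numFaces = R.numEdges + 2 := hR.spherical
  have hsize := hR.size
  obtain ⟨N, w, s, h⟩ := hK.exists_reading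
    (hK.faceCorners hR.bothDirections_codual (n := n) (by omega) (by omega)) hR.connected_codual
  exact h.isPCPrograph_cut hK hcard

end IsBipolarTriangulation

end RootedData

/-! ## The bijections -/

variable {n : ℕ}

theorem Tableau.bijOn_toPrograph [NeZero n] :
    Set.BijOn (fun T : Tableau n => T.toPrograph) Set.univ (pcPrographs n) := by
  refine ⟨fun T _ => ⟨_, T.isPCPrograph, rfl⟩, fun T _ T' _ h => ?_, ?_⟩
  · have hiso : T.prograph.Iso T'.prograph := Quotient.exact h
    rw [prograph_eq, prograph_eq] at hiso
    exact eq_of_word_eq fun _ hi => T.isSweep.word_eq_of_iso T'.isSweep hiso.closed hi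
  · rintro _ ⟨M, hM, rfl⟩
    obtain ⟨w, s, h⟩ := hM.exists_reading
    obtain ⟨T, hT⟩ := h.exists_tableau
    have hclosed := T.isReading.iso isCubic h hM.isCubic hT
    refine ⟨T, trivial, Quotient.sound ?_⟩
    rw [prograph_eq]
    exact PrographData.Iso.of_closed hasLegs hM.hasLegs hclosed

theorem bijOn_dual :
    Set.BijOn PrographClass.dual (pcPrographs n) (bipolarTriangulations n) := by
  refine ⟨?_, ?_, ?_⟩
  · rintro _ ⟨M, hM, rfl⟩
    exact ⟨M.dual, hM.isBipolarTriangulation_dual, rfl⟩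
  · rintro _ ⟨M, hM, rfl⟩ _ ⟨M', hM', rfl⟩ h
    have hiso : M.closed.dual.Iso M'.closed.dual := Quotient.exact h
    exact Quotient.sound (.of_closed hM.hasLegs hM'.hasLegs hiso.of_dual)
  · rintro _ ⟨R, hR, rfl⟩
    have hdual : R.codual.cut.dual = R :=
      (congrArg RootedData.dual RootedData.closed_cut).trans RootedData.dual_codual
    exact ⟨_, ⟨R.codual.cut, hR.isPCPrograph_cut_codual, rfl⟩, congrArg (Quotient.mk _) hdual⟩

theorem Tableau.toTriangulation_schutzenberger [NeZero n] (T : Tableau n) :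
    T.schutzenberger.toTriangulation = T.toTriangulation.rotate := by
  have hiso : T.schutzenberger.gluedPrograph.closed.Iso T.gluedPrograph.closed.rotate :=
    T.schutzenberger.isReading.iso isCubic (T.isReading.rotate isCubic) isCubic.rotate
      fun i hi => word_schutzenberger hi
  change Quotient.mk _ T.schutzenberger.prograph.dual = Quotient.mk _ T.prograph.dual.rotate
  rw [prograph_eq, prograph_eq]
  exact Quotient.sound hiso.dual

end PC

theorem theorem1 (n : ℕ) [NeZero n] :
    Set.BijOn (fun T : PC.Tableau n => T.toPrograph) Set.univ (PC.pcPrographs n) ∧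
    Set.BijOn PC.PrographClass.dual (PC.pcPrographs n) (PC.bipolarTriangulations n) ∧
    Set.BijOn (fun T : PC.Tableau n => T.toTriangulation) Set.univ (PC.bipolarTriangulations n) ∧
    ∀ T : PC.Tableau n, T.schutzenberger.toTriangulation = T.toTriangulation.rotate :=
  ⟨PC.Tableau.bijOn_toPrograph, PC.bijOn_dual, PC.bijOn_dual.comp PC.Tableau.bijOn_toPrograph,
    PC.Tableau.toTriangulation_schutzenberger⟩
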